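/- Let $R$ be a ring with identity, let $\kappa$ be an infinite cardinal with $\kappa \geq \mathrm{Card}(R)$, and let $n \geq 0$ be an integer. Let $\mathcal{P}_n$ be the class of left $R$-modules $M$ having a projective resolution of length $n$, i.e. an exact sequence $0 \to P_n \to \cdots \to P_1 \to P_0 \to M \to 0$ with every $P_k$ projective, and let $\mathcal{P}_n^{\leq\kappa}$ be the class of those $M$ having such a resolution with $\mathrm{Card}(P_k) \leq \kappa$ for all $k$. For a class $\mathcal{A}$ of left $R$-modules, let $\mathrm{ex}\widetilde{\mathcal{A}}$ be the class of exact ($\mathbb{Z}$-graded, unbounded) chain complexes $X$ of left $R$-modules with $X_m \in \mathcal{A}$ for all $m \in \mathbb{Z}$. For a class $\mathcal{C}$ of chain complexes, let $\mathcal{C}^\perp$ (respectively ${}^\perp\mathcal{C}$) be the class of chain complexes $Y$ with $\mathrm{Ext}^1(X, Y) = 0$ (respectively $\mathrm{Ext}^1(Y, X) = 0$) for all $X \in \mathcal{C}$, where $\mathrm{Ext}^1$ is taken in the abelian category of chain complexes of left $R$-modules. (1) Every $X \in \mathrm{ex}\widetilde{\mathcal{P}_n}$ has an $\mathrm{ex}\widetilde{\mathcal{P}_n^{\leq\kappa}}$-filtration: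 there are an ordinal $\lambda > 0$ and a family $(X^\alpha)_{\alpha < \lambda}$ of subcomplexes of $X$ such that $X^0 = 0$, $X^\alpha \subseteq X^\beta$ whenever $\alpha \leq \beta < \lambda$, $X^\beta = \bigcup_{\alpha < \beta} X^\alpha$ for every limit ordinal $\beta < \lambda$, $X = \bigcup_{\alpha < \lambda} X^\alpha$, and $X^0$ as well as each quotient $X^{\alpha+1}/X^\alpha$ with $\alpha + 1 < \lambda$ is isomorphic to a complex in $\mathrm{ex}\widetilde{\mathcal{P}_n^{\leq\kappa}}$. (2) The class $\mathrm{ex}\widetilde{\mathcal{P}_n^{\leq\kappa}}$ has, up to isomorphism, only a set of members, and $(\mathrm{ex}\widetilde{\mathcal{P}_n}, (\mathrm{ex}\widetilde{\mathcal{P}_n})^\perp)$ is a complete cotorsion pair cogenerated by $\mathrm{ex}\widetilde{\mathcal{P}_n^{\leq\kappa}}$, and also by some set of complexes contained in $\mathrm{ex}\widetilde{\mathcal{P}_n^{\leq\kappa}}$. Here $(\mathcal{C}, \mathcal{D})$ is a cotorsion pair if $\mathcal{C} = {}^\perp\mathcal{D}$ and $\mathcal{D} = \mathcal{C}^\perp$;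 it is complete if for every complex $X$ there are short exact sequences $0 \to D \to C \to X \to 0$ and $0 \to X \to D' \to C' \to 0$ with $C, C' \in \mathcal{C}$ and $D, D' \in \mathcal{D}$; and it is cogenerated by $\mathcal{S}$ if $\mathcal{S} \subseteq \mathcal{C}$ and $\mathcal{D} = \mathcal{S}^\perp$. -/

import Mathlib

open CategoryTheory CategoryTheory.Abelian

universe u v w

/-! ### Cotorsion pairs in an abelian category -/

section CotorsionPairs

variable {C : Type u} [Category.{v} C] [Abelian C] [HasExt.{w} C]

/-- The class `P^⊥` of all `Y` with `Ext¹(X, Y) = 0` for every `X` in `P`. -/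
def rightPerp (P : ObjectProperty C) : ObjectProperty C :=
  fun Y => ∀ X : C, P X → Subsingleton (Ext.{w} X Y 1)

/-- The class `^⊥P` of all `X` with `Ext¹(X, Y) = 0` for every `Y` in `P`. -/
def leftPerp (P : ObjectProperty C) : ObjectProperty C :=
  fun X => ∀ Y : C, P Y → Subsingleton (Ext.{w} X Y 1)

/-- `(A, B)` is a cotorsion pair: `A = ^⊥B` and `B = A^⊥`. -/
structure IsCotorsionPair (A B : ObjectProperty C) : Prop where
  left_eq : A = leftPerp.{u, v, w} B
  right_eq : B = rightPerp.{u, v, w} A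

/-- `(A, B)` is a complete cotorsion pair: every object `X` sits in short exact sequences
`0 → B₀ → A₀ → X → 0` and `0 → X → B₁ → A₁ → 0` with `A₀, A₁` in `A` and `B₀, B₁` in `B`. -/
structure IsCompleteCotorsionPair (A B : ObjectProperty C) : Prop
    extends IsCotorsionPair.{u, v, w} A B where
  enoughProjectives : ∀ X : C, ∃ (B₀ A₀ : C) (i : B₀ ⟶ A₀) (p : A₀ ⟶ X) (h : i ≫ p = 0),
    A A₀ ∧ B B₀ ∧ (ShortComplex.mk i p h).ShortExact
  enoughInjectives : ∀ X : C, ∃ (B₁ A₁ : C) (i : X ⟶ B₁) (p : B₁ ⟶ A₁) (h : i ≫ p = 0),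
    A A₁ ∧ B B₁ ∧ (ShortComplex.mk i p h).ShortExact

/-- `(A, B)` is cogenerated by the class `S`: `S ⊆ A` and `B = S^⊥`. -/
structure IsCogeneratedBy (A B S : ObjectProperty C) : Prop where
  subset : S ≤ A
  right_eq : B = rightPerp.{u, v, w} S

end CotorsionPairs

/-! ### Modules with projective resolutions of length `n` -/

section Modules

variable {R : Type u} [Ring R]

/-- An exact sequence `0 → P n → ⋯ → P 1 → P 0 → M → 0` with projective `P k`.
The sequence is extended to the left by zero modules `P k`, `k > n`. -/
structure ProjResOfLength (n : ℕ) (M : ModuleCat.{u} R) where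
  P : ℕ → ModuleCat.{u} R
  d : ∀ k, P (k + 1) →ₗ[R] P k
  aug : P 0 →ₗ[R] M
  projective : ∀ k, Module.Projective R (P k)
  subsingleton : ∀ k, n < k → Subsingleton (P k)
  exact_succ : ∀ k, Function.Exact (d (k + 1)) (d k)
  exact_zero : Function.Exact (d 0) aug
  surjective : Function.Surjective aug

/-- The class `𝒫ₙ` of modules of projective dimension at most `n`. -/
def nProjective (R : Type u) [Ring R] (n : ℕ) : ObjectProperty (ModuleCat.{u} R) :=
  fun M => Nonempty (ProjResOfLength n M)

/-- The class `𝒫ₙ^{≤ κ}` of modules with a projective resolution of length `n` all of whose terms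
have cardinality at most `κ`. -/
def smallNProjective (R : Type u) [Ring R] (n : ℕ) (κ : Cardinal.{u}) :
    ObjectProperty (ModuleCat.{u} R) :=
  fun M => ∃ r : ProjResOfLength n M, ∀ k, Cardinal.mk (r.P k) ≤ κ

end Modules

/-! ### Chain complexes, subcomplexes and filtrations -/

section Complexes

variable {R : Type u} [Ring R]

/-- For a class `A` of modules, the class of exact chain complexes with all terms in `A`. -/
def exTilde (A : ObjectProperty (ModuleCat.{u} R)) :
    ObjectProperty (ChainComplex (ModuleCat.{u} R) ℤ) :=
  fun X => (∀ m : ℤ, X.ExactAt m) ∧ ∀ m : ℤ, A (X.X m)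

/-- A subcomplex: submodules `carrier m ≤ X_m` preserved by the differential. -/
@[ext]
structure Subcomplex (X : ChainComplex (ModuleCat.{u} R) ℤ) where
  carrier : ∀ m : ℤ, Submodule R (X.X m)
  map_d : ∀ i j : ℤ, carrier i ≤ (carrier j).comap (X.d i j).hom

namespace Subcomplex

variable {X : ChainComplex (ModuleCat.{u} R) ℤ}

/-- A subcomplex as a chain complex. -/
def toComplex (Y : Subcomplex X) : ChainComplex (ModuleCat.{u} R) ℤ where
  X m := ModuleCat.of R (Y.carrier m)
  d i j := ModuleCat.ofHom ((X.d i j).hom.restrict (Y.map_d i j))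
  shape i j h := by
    ext x
    change (X.d i j).hom (x : X.X i) = 0
    rw [X.shape i j h]
    rfl
  d_comp_d' i j k _ _ := by
    ext x
    change (X.d i j ≫ X.d j k).hom (x : X.X i) = 0
    rw [X.d_comp_d i j k]
    rfl

/-- The quotient complex `X / Y`, with terms `X_m / Y_m` and the induced differential. -/
def quotient (Y : Subcomplex X) : ChainComplex (ModuleCat.{u} R) ℤ where
  X m := ModuleCat.of R (X.X m ⧸ Y.carrier m)
  d i j := ModuleCat.ofHom (Submodule.mapQ _ _ (X.d i j).hom (Y.map_d i j))
  shape i j h := by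
    ext x
    simp [X.shape i j h]
  d_comp_d' i j k _ _ := by
    ext x
    change (Y.carrier k).mkQ ((X.d i j ≫ X.d j k).hom x) = 0
    rw [X.d_comp_d i j k]
    exact map_zero _

/-- The trace of the subcomplex `Y` on the subcomplex `Z`, as a subcomplex of `Z`; it is `Y` itself
when `Y ⊆ Z`. -/
def within (Y Z : Subcomplex X) : Subcomplex Z.toComplex where
  carrier m := (Y.carrier m).submoduleOf (Z.carrier m)
  map_d i j := fun _ hx => Y.map_d i j hx

end Subcomplex

/-- `(F α : α < l)` is an `S`-filtration of `X`: an increasing continuous chain of subcomplexes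
starting at `F 0 = 0`, with union `X`, such that `F 0` and the quotients `F (α + 1) / F α` are
isomorphic to members of `S`. Values `F α` with `α ≥ l` play no role. -/
structure IsFiltrationOf (S : ObjectProperty (ChainComplex (ModuleCat.{u} R) ℤ))
    (X : ChainComplex (ModuleCat.{u} R) ℤ) (l : Ordinal.{u}) (F : Ordinal.{u} → Subcomplex X) :
    Prop where
  pos : 0 < l
  zero : ∀ m, (F 0).carrier m = ⊥
  mono : ∀ α β, α ≤ β → β < l → ∀ m, (F α).carrier m ≤ (F β).carrier m
  limit : ∀ β, β < l → Order.IsSuccLimit β → ∀ m, ∀ x : X.X m,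
    x ∈ (F β).carrier m → ∃ α < β, x ∈ (F α).carrier m
  union : ∀ m, ∀ x : X.X m, ∃ α < l, x ∈ (F α).carrier m
  mem_zero : S.isoClosure (F 0).toComplex
  mem_succ : ∀ α, Order.succ α < l →
    S.isoClosure ((F α).within (F (Order.succ α))).quotient

/-- `X` has an `S`-filtration, indexed by some ordinal. -/
def HasFiltration (S : ObjectProperty (ChainComplex (ModuleCat.{u} R) ℤ))
    (X : ChainComplex (ModuleCat.{u} R) ℤ) : Prop :=
  ∃ (l : Ordinal.{u}) (F : Ordinal.{u} → Subcomplex X), IsFiltrationOf S X l F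

end Complexes

/-!
The proof has three parts, which meet in the equality `(exTilde 𝒫ₙ)^⊥ = T^⊥` for a set `T` of small
complexes.

*Filtrations.* Choose a projective resolution of length `n` of every term of an exact complex `X`,
and realize every projective module `P` which occurs as a retract of a free module `F`. Consider
families of submodules of all these modules, one in each, which are spanned by basis elements in the
free modules and which are *strict* (`IsStrict`): every map `f` involved satisfies
`f(N) = N ∩ range f`. Strictness says at once that the families are subcomplexes, that they are
exact and that the quotients by them are exact, and compatibility with the retractions `P → F → P`
makes the quotients of the resolutions projective. Closing up countably often, a strict family is
enlarged by any `κ` elements at the cost of `κ` generators (`IsStrict.exists_extension`). Hence good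
families with small subquotients exhaust `X`, which gives the filtration
(`hasFiltration_of_exTilde`), and a map from `X` is lifted along an epimorphism with kernel in
`(exTilde 𝒫ₙ^{≤ κ})^⊥` step by step, which gives the equality of right orthogonal classes
(`rightPerp_small_le`).

*Completeness.* In a Grothendieck abelian category with a projective separator, the pair
`(^⊥(T^⊥), T^⊥)` of a set `T` is complete (`isCompleteCotorsionPair_of_set`): a monomorphism with
cokernel left orthogonal to `Y` lifts against every epimorphism with kernel `Y`, so the small object
argument for the presentations of the members of `T` and of the separator, applied to `0 → X` and to
`X → 0`, produces the two short exact sequences.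

*The left class.* It remains to see that `^⊥((exTilde 𝒫ₙ)^⊥) ⊆ exTilde 𝒫ₙ`
(`leftPerp_rightPerp_exTilde`). For this it is enough to test against two kinds of complexes. The
contractible complex `discComplex N` satisfies `Ext¹(X, discComplex N) = ∏ Ext¹(Xₘ, N)`, and when
`N` is an `n`-th cosyzygy of `K` the factors vanish if and only if `Ext^{n+1}(Xₘ, K)` does. The
complex `sphereComplex E` with `E` injective and zero differential detects exactness. The complex
`discComplex R` is also the projective separator needed above.
-/

/-! ### Vanishing of `Ext¹` as a lifting property -/

section ExtLifting

variable {C : Type u} [Category.{v} C] [Abelian C] [HasExt.{w} C]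

/-- Maps from an object left orthogonal to the kernel lift along an epimorphism. -/
lemma exists_lift_of_subsingleton_ext {X : C} {S : ShortComplex C} (hS : S.ShortExact)
    (h : Subsingleton (Ext.{w} X S.X₁ 1)) (g : X ⟶ S.X₃) : ∃ φ : X ⟶ S.X₂, φ ≫ S.g = g := by
  obtain ⟨φ, hφ⟩ := Ext.covariant_sequence_exact₃ X hS (Ext.mk₀ g) (zero_add 1)
    (Subsingleton.elim _ _)
  obtain ⟨φ, rfl⟩ := Ext.homEquiv₀.symm.surjective φ
  exact ⟨φ, Ext.homEquiv₀.symm.injective (by simpa using hφ)⟩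

lemma exists_extension_of_subsingleton_ext {Y : C} {S : ShortComplex C} (hS : S.ShortExact)
    (h : Subsingleton (Ext.{w} S.X₃ Y 1)) (g : S.X₁ ⟶ Y) : ∃ φ : S.X₂ ⟶ Y, S.f ≫ φ = g := by
  obtain ⟨φ, hφ⟩ := Ext.contravariant_sequence_exact₁ hS Y (Ext.mk₀ g) (add_zero 1)
    (Subsingleton.elim _ _)
  obtain ⟨φ, rfl⟩ := Ext.homEquiv₀.symm.surjective φ
  exact ⟨φ, Ext.homEquiv₀.symm.injective (by simpa using hφ)⟩

/-- If `Ext¹(X, S.X₂) = 0`, then the vanishing of `Ext¹(X, S.X₁)` is detected by lifting maps along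
`S.g`. -/
lemma subsingleton_ext_of_lift {X : C} {S : ShortComplex C} (hS : S.ShortExact)
    (h : Subsingleton (Ext.{w} X S.X₂ 1))
    (hl : ∀ g : X ⟶ S.X₃, ∃ φ : X ⟶ S.X₂, φ ≫ S.g = g) : Subsingleton (Ext.{w} X S.X₁ 1) := by
  refine subsingleton_of_forall_eq 0 fun x => ?_
  obtain ⟨y, rfl⟩ := Ext.covariant_sequence_exact₁ X hS x (Subsingleton.elim _ _) (zero_add 1)
  obtain ⟨g, rfl⟩ := Ext.homEquiv₀.symm.surjective y
  obtain ⟨φ, rfl⟩ := hl g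
  simp only [Ext.homEquiv₀_symm_apply]
  rw [← Ext.mk₀_comp_mk₀, Ext.comp_assoc_of_second_deg_zero, hS.comp_extClass, Ext.comp_zero]

lemma subsingleton_ext_of_extension {Y : C} {S : ShortComplex C} (hS : S.ShortExact)
    (h : Subsingleton (Ext.{w} S.X₂ Y 1))
    (hl : ∀ g : S.X₁ ⟶ Y, ∃ φ : S.X₂ ⟶ Y, S.f ≫ φ = g) : Subsingleton (Ext.{w} S.X₃ Y 1) := by
  refine subsingleton_of_forall_eq 0 fun x => ?_
  obtain ⟨y, rfl⟩ := Ext.contravariant_sequence_exact₃ hS Y x (Subsingleton.elim _ _) (add_zero 1)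
  obtain ⟨g, rfl⟩ := Ext.homEquiv₀.symm.surjective y
  obtain ⟨φ, rfl⟩ := hl g
  simp only [Ext.homEquiv₀_symm_apply]
  rw [← Ext.mk₀_comp_mk₀, hS.extClass_comp_assoc]

lemma subsingleton_ext_of_iso {X X' : C} (e : X ≅ X') (Y : C) (n : ℕ)
    (h : Subsingleton (Ext.{w} X Y n)) : Subsingleton (Ext.{w} X' Y n) := by
  refine subsingleton_of_forall_eq 0 fun x => ?_
  rw [← x.mk₀_id_comp, ← e.inv_hom_id, ← Ext.mk₀_comp_mk₀_assoc,
    Subsingleton.elim ((Ext.mk₀ e.hom).comp x (zero_add n)) 0, Ext.comp_zero]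

/-- A monomorphism whose cokernel is left orthogonal to `Y` lifts against every epimorphism with
kernel `Y`. -/
lemma hasLiftingProperty_of_subsingleton_ext {S T : ShortComplex C} (hS : S.ShortExact)
    (hT : T.ShortExact) (h : Subsingleton (Ext.{w} S.X₃ T.X₁ 1)) :
    HasLiftingProperty S.f T.g where
  sq_hasLift {u v} sq := by
    have := hT.mono_f
    -- the obstruction to lifting `v` vanishes on `S.X₁`, where `u` is a lift
    have hv : (Ext.mk₀ v).comp hT.extClass (zero_add 1) = 0 := by
      obtain ⟨y, hy⟩ := Ext.contravariant_sequence_exact₂ hS T.X₁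
        ((Ext.mk₀ v).comp hT.extClass (zero_add 1)) (by
          rw [Ext.mk₀_comp_mk₀_assoc, ← sq.w, ← Ext.mk₀_comp_mk₀,
            Ext.comp_assoc_of_second_deg_zero, hT.comp_extClass, Ext.comp_zero])
      rw [← hy, Subsingleton.elim y 0, Ext.comp_zero]
    obtain ⟨w, hw⟩ := Ext.covariant_sequence_exact₃ _ hT (Ext.mk₀ v) (zero_add 1) hv
    obtain ⟨w, rfl⟩ := Ext.homEquiv₀.symm.surjective w
    have hw' : w ≫ T.g = v := Ext.homEquiv₀.symm.injective (by simpa using hw)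
    have hz : (S.f ≫ w - u) ≫ T.g = 0 := by
      rw [Preadditive.sub_comp, Category.assoc, hw', sq.w, sub_self]
    obtain ⟨ψ, hψ⟩ := exists_extension_of_subsingleton_ext hS h (hT.exact.lift _ hz)
    refine ⟨⟨⟨w - ψ ≫ T.f, ?_, ?_⟩⟩⟩
    · rw [Preadditive.comp_sub, ← Category.assoc, hψ, hT.exact.lift_f]; abel
    · rw [Preadditive.sub_comp, Category.assoc, T.zero, Limits.comp_zero, sub_zero, hw']

end ExtLifting

/-! ### The small object argument -/

section SmallObject
open Limits MorphismProperty ZeroObject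

variable {C : Type u} [Category.{v} C] [Abelian C] [IsGrothendieckAbelian.{w} C]

/-- In a Grothendieck abelian category, every set of monomorphisms permits the small object
argument. -/
lemma hasSmallObjectArgument_of_mono {ι : Type w} {A B : ι → C} (f : ∀ i, A i ⟶ B i)
    [∀ i, Mono (f i)] : HasSmallObjectArgument.{w} (ofHoms f) := by
  obtain ⟨κ, hκ', hκ⟩ :=
    HasCardinalLT.exists_regular_cardinal.{w} (Σ i, Shrink.{w} (Subobject (A i)))
  have : Fact κ.IsRegular := ⟨hκ'⟩
  have : Nonempty κ.ord.ToType := by simpa using hκ'.ne_zero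
  have := WellFoundedLT.toOrderBot κ.ord.ToType
  have hle : ofHoms f ≤ monomorphisms C := by
    rintro _ _ _ ⟨i⟩
    exact inferInstanceAs (Mono (f i))
  refine ⟨κ, inferInstance, inferInstance,
    { preservesColimit := ?_ }⟩
  intro A' B' X Y i hi g hg
  let hg' : (monomorphisms C).TransfiniteCompositionOfShape κ.ord.ToType g :=
    { toTransfiniteCompositionOfShape := hg.toTransfiniteCompositionOfShape
      map_mem j hj := by
        have := (hg.attachCells j hj).pushouts_coproducts
        simp only [ofHoms_homFamily] at this
        refine (?_ : _ ≤ monomorphisms C) _ this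
        simp only [pushouts_le_iff, coproducts_le_iff]
        exact hle }
  have (j j' : κ.ord.ToType) (φ : j ⟶ j') : Mono (hg'.F.map φ) := hg'.mem_map φ
  refine IsGrothendieckAbelian.preservesColimit_coyoneda_obj_of_mono (Y := hg'.F) (κ := κ) ?_
  obtain ⟨j⟩ := hi
  exact hκ.of_injective (fun s => ⟨j, equivShrink _ s⟩)
    (fun a b h => (equivShrink _).injective (by simpa using h))

/-- Embedding `X` in an injective object `J` and extending the embedding along `f` shows that `f` is
a monomorphism. -/
lemma mono_of_llp_of_injective {X Y : C} (f : X ⟶ Y)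
    (h : ∀ (J : C) [Injective J], HasLiftingProperty f (0 : J ⟶ 0)) : Mono f := by
  have := h (Injective.under X)
  have sq : CommSq (Injective.ι X) f (0 : Injective.under X ⟶ 0) 0 := ⟨by simp⟩
  have : Mono (f ≫ sq.lift) := by rw [sq.fac_left]; infer_instance
  exact mono_of_mono f sq.lift

end SmallObject

/-! ### Completeness of the cotorsion pair cogenerated by a set -/

section Complete
open Limits MorphismProperty ZeroObject

variable {C : Type u} [Category.{v} C] [Abelian C] [HasExt.{v} C]

lemma le_leftPerp_rightPerp (P : ObjectProperty C) :
    P ≤ leftPerp.{u, v, v} (rightPerp.{u, v, v} P) := fun X hX _ hY => hY X hX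

lemma rightPerp_leftPerp_rightPerp (P : ObjectProperty C) :
    rightPerp.{u, v, v} (leftPerp.{u, v, v} (rightPerp.{u, v, v} P)) = rightPerp.{u, v, v} P := by
  ext Y
  exact ⟨fun h X hX => h X (le_leftPerp_rightPerp P X hX), fun h X hX => hX Y h⟩

variable [IsGrothendieckAbelian.{v} C]

omit [HasExt.{v} C] in
/-- A projective separator provides enough projective objects. -/
lemma exists_projective_epi {G : C} [Projective G] (hG : IsSeparator G) (X : C) :
    ∃ (P : C) (p : P ⟶ X), Projective P ∧ Epi p :=
  ⟨∐ fun _ : G ⟶ X => G, Sigma.desc fun f => f, inferInstance,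
    (isSeparator_iff_epi G).1 hG X⟩

/-- The cotorsion pair cogenerated by a set of objects is complete, by the small object argument
applied to presentations `K i ⟶ P i` of the objects of the set and of a projective separator. -/
theorem isCompleteCotorsionPair_of_set {G : C} [Projective G] (hG : IsSeparator G) {ι : Type v}
    (S : ι → C) : IsCompleteCotorsionPair.{u, v, v}
      (leftPerp.{u, v, v} (rightPerp.{u, v, v} (ObjectProperty.ofObj S)))
      (rightPerp.{u, v, v} (ObjectProperty.ofObj S)) := by
  let Z : Option ι → C := fun i => i.elim G S
  choose P p hP hp using fun i => exists_projective_epi hG (Z i)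
  let I : MorphismProperty C := ofHoms fun i => kernel.ι (p i)
  have : HasSmallObjectArgument.{v} I := hasSmallObjectArgument_of_mono _
  have hses (i) : (ShortComplex.mk _ _ (kernel.condition (p i))).ShortExact :=
    { exact := ShortComplex.exact_kernel _ }
  set B := rightPerp.{u, v, v} (ObjectProperty.ofObj S) with hB
  -- epimorphisms with kernel in `B` lift against the generating monomorphisms
  have hrlp (T : ShortComplex C) (hT : T.ShortExact) (h : B T.X₁) : I.rlp T.g := by
    rintro _ _ _ ⟨i⟩
    refine hasLiftingProperty_of_subsingleton_ext (hses i) hT ?_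
    cases i with
    | none => exact Ext.subsingleton_of_projective G T.X₁ 0
    | some i => exact h _ ⟨i⟩
  have hinj (J : C) [Injective J] : B J := fun X _ => Ext.subsingleton_of_injective X J 0
  have hJ (J : C) : (ShortComplex.mk (𝟙 J) (0 : J ⟶ 0) (by simp)).ShortExact := by
    exact ShortComplex.Splitting.shortExact
      { r := 𝟙 J, s := 0, f_r := by simp, s_g := (isZero_zero C).eq_of_src _ _, id := by simp }
  -- a map lifting against all such epimorphisms is a monomorphism with cokernel in `leftPerp B`
  have hmono {X Y : C} (f : X ⟶ Y) (hf : I.rlp.llp f) : Mono f :=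
    mono_of_llp_of_injective f fun J _ => hf _ (hrlp _ (hJ J) (hinj J))
  have hcok {X Y : C} (f : X ⟶ Y) (hf : I.rlp.llp f) : leftPerp.{u, v, v} B (cokernel f) := by
    intro K hK
    have hs : (ShortComplex.mk _ _ (cokernel.condition (Injective.ι K))).ShortExact :=
      { exact := ShortComplex.exact_cokernel _ }
    refine subsingleton_ext_of_lift hs (Ext.subsingleton_of_injective _ _ 0) fun g => ?_
    have sq : CommSq (0 : X ⟶ _) f (cokernel.π (Injective.ι K)) (cokernel.π f ≫ g) := ⟨by simp⟩
    have := hf _ (hrlp _ hs hK)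
    refine ⟨cokernel.desc f sq.lift sq.fac_left, ?_⟩
    rw [← cancel_epi (cokernel.π f)]
    simp
  -- a map with the right lifting property is an epimorphism with kernel in `B`
  have hlift {A X : C} (q : A ⟶ X) (hq : I.rlp q) (i) (g : Z i ⟶ X) : ∃ φ, φ ≫ q = g := by
    have sq : CommSq (0 : kernel (p i) ⟶ A) (kernel.ι (p i)) q (p i ≫ g) := ⟨by simp⟩
    have := hq _ (ofHoms.mk i)
    refine ⟨(hses i).exact.desc sq.lift sq.fac_left, ?_⟩
    rw [← cancel_epi (p i), ← Category.assoc]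
    exact (congrArg (· ≫ q) ((hses i).exact.g_desc _ _)).trans sq.fac_right
  have hepi {A X : C} (q : A ⟶ X) (hq : I.rlp q) : Epi q := by
    refine ⟨fun {W} a b hab => hG.def _ _ fun g => ?_⟩
    obtain ⟨φ, rfl⟩ : ∃ φ : G ⟶ A, φ ≫ q = g := hlift q hq none g
    simp [hab]
  have hker {K A X : C} (k : K ⟶ A) (q : A ⟶ X) (h : k ≫ q = 0)
      (hT : (ShortComplex.mk k q h).ShortExact) (hq : I.rlp q) : B K := by
    rintro _ ⟨i⟩
    have := hT.mono_f
    refine subsingleton_ext_of_extension (hses (some i)) (Ext.subsingleton_of_projective _ _ 0)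
      fun g => ?_
    have sq : CommSq (g ≫ k) (kernel.ι (p (some i))) q 0 := ⟨by simp [h]⟩
    have := hq _ (ofHoms.mk (some i))
    refine ⟨hT.exact.lift sq.lift sq.fac_right, ?_⟩
    rw [← cancel_mono k, Category.assoc]
    exact (congrArg (_ ≫ ·) (hT.exact.lift_f _ _)).trans sq.fac_left
  refine { left_eq := rfl, right_eq := (rightPerp_leftPerp_rightPerp _).symm
           enoughProjectives := fun X => ?_, enoughInjectives := fun X => ?_ }
  · let D := (functorialFactorizationData I.rlp.llp I.rlp).factorizationData (0 : 0 ⟶ X)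
    have := hepi D.p D.hp
    have hs : (ShortComplex.mk _ _ (kernel.condition D.p)).ShortExact :=
      { exact := ShortComplex.exact_kernel _ }
    have hi : D.i = 0 := (isZero_zero C).eq_of_src _ _
    refine ⟨kernel D.p, D.Z, _, _, _, fun Y hY => ?_, hker _ _ _ hs D.hp, hs⟩
    have : IsIso (cokernel.π D.i) := by rw [hi]; infer_instance
    exact subsingleton_ext_of_iso (asIso (cokernel.π D.i)).symm Y 1 (hcok D.i D.hi Y hY)
  · let D := (functorialFactorizationData I.rlp.llp I.rlp).factorizationData (0 : X ⟶ 0)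
    have := hmono D.i D.hi
    have hp : D.p = 0 := (isZero_zero C).eq_of_tgt _ _
    exact ⟨D.Z, cokernel D.i, D.i, cokernel.π D.i, cokernel.condition _, hcok _ D.hi,
      hker (𝟙 _) (0 : D.Z ⟶ 0) (by simp) (hJ D.Z) (hp ▸ D.hp),
      { exact := ShortComplex.exact_cokernel _ }⟩

end Complete

/-! ### Cardinality bounds -/

section Cardinals

lemma mk_iUnion_le_of_countable {α : Type u} {ι : Type v} [Countable ι] {κ : Cardinal.{u}}
    (hκ : Cardinal.aleph0 ≤ κ) (s : ι → Set α) (h : ∀ i, Cardinal.mk (s i) ≤ κ) :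
    Cardinal.mk (⋃ i, s i) ≤ κ := by
  refine Cardinal.lift_le.{v}.1 ((Cardinal.mk_iUnion_le_lift s).trans ?_)
  have h1 : Cardinal.lift.{u} (Cardinal.mk ι) ≤ Cardinal.lift.{v} κ :=
    (Cardinal.lift_le_aleph0.2 (Cardinal.mk_le_aleph0)).trans (Cardinal.aleph0_le_lift.2 hκ)
  have h2 : ⨆ i, Cardinal.lift.{v} (Cardinal.mk (s i)) ≤ Cardinal.lift.{v} κ :=
    ciSup_le' fun i => Cardinal.lift_le.2 (h i)
  exact (mul_le_mul' h1 h2).trans (Cardinal.mul_eq_self (Cardinal.aleph0_le_lift.2 hκ)).le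

lemma mk_union_le_of_le {α : Type u} {κ : Cardinal.{u}} (hκ : Cardinal.aleph0 ≤ κ) {s t : Set α}
    (hs : Cardinal.mk s ≤ κ) (ht : Cardinal.mk t ≤ κ) : Cardinal.mk (s ∪ t : Set α) ≤ κ :=
  (Cardinal.mk_union_le s t).trans (Cardinal.add_le_of_le hκ hs ht)

lemma mk_finsupp_le_of_le {α M : Type u} [Zero M] {κ : Cardinal.{u}} (hκ : Cardinal.aleph0 ≤ κ)
    (hα : Cardinal.mk α ≤ κ) (hM : Cardinal.mk M ≤ κ) : Cardinal.mk (α →₀ M) ≤ κ := by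
  classical
  refine (Cardinal.mk_le_of_injective (Finsupp.graph_injective α M)).trans
    ((Cardinal.mk_le_of_surjective List.toFinset_surjective).trans
    ((Cardinal.mk_list_le_max _).trans (max_le hκ ?_)))
  rw [Cardinal.mk_prod, Cardinal.lift_id, Cardinal.lift_id]
  exact (mul_le_mul' hα hM).trans (Cardinal.mul_eq_self hκ).le

lemma mk_span_le_of_le {R M : Type u} [Ring R] [AddCommGroup M] [Module R M] {κ : Cardinal.{u}}
    (hκ : Cardinal.aleph0 ≤ κ) (hR : Cardinal.mk R ≤ κ) {T : Set M} (hT : Cardinal.mk T ≤ κ) :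
    Cardinal.mk (Submodule.span R T) ≤ κ := by
  rw [Finsupp.span_eq_range_linearCombination]
  exact (Cardinal.mk_le_of_surjective
    (LinearMap.surjective_rangeRestrict (Finsupp.linearCombination R (Subtype.val : T → M)))).trans
    (mk_finsupp_le_of_le hκ hT hR)

end Cardinals

/-! ### Strict families of submodules -/

section StrictFamilies

variable {R : Type u} [Ring R]

/-- A set of submodules closed under arbitrary sums in which every member can be enlarged, by
adjoining at most `κ` generators, so as to absorb any `κ` given elements. -/
structure IsAmple {M : Type u} [AddCommGroup M] [Module R M] (κ : Cardinal.{u})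
    (G : Set (Submodule R M)) : Prop where
  sSup_mem : ∀ s ⊆ G, sSup s ∈ G
  extend : ∀ N ∈ G, ∀ Z : Set M, Cardinal.mk Z ≤ κ →
    ∃ T, Z ⊆ T ∧ Cardinal.mk T ≤ κ ∧ N ⊔ Submodule.span R T ∈ G

lemma isAmple_univ {M : Type u} [AddCommGroup M] [Module R M] (κ : Cardinal.{u}) :
    IsAmple κ (Set.univ : Set (Submodule R M)) :=
  ⟨fun _ _ => trivial, fun _ _ Z hZ => ⟨Z, subset_rfl, hZ, trivial⟩⟩

lemma isAmple_supported {ι : Type u} {κ : Cardinal.{u}} (hκ : Cardinal.aleph0 ≤ κ) :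
    IsAmple κ (Set.range (Finsupp.supported R R : Set ι → Submodule R (ι →₀ R))) := by
  classical
  refine ⟨fun s hs => ?_, ?_⟩
  · refine ⟨⋃ A : {A : Set ι // Finsupp.supported R R A ∈ s}, A.1, ?_⟩
    rw [Finsupp.supported_iUnion]
    refine le_antisymm (iSup_le fun A => le_sSup A.2) (sSup_le fun N hN => ?_)
    obtain ⟨A, rfl⟩ := hs hN
    exact le_iSup (fun A : {A : Set ι // Finsupp.supported R R A ∈ s} =>
      Finsupp.supported R R A.1) ⟨A, hN⟩
  · rintro _ ⟨A, rfl⟩ Z hZ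
    let B : Set ι := ⋃ z : Z, (z.1.support : Set ι)
    have hB : Cardinal.mk B ≤ κ := by
      refine (Cardinal.mk_iUnion_le _).trans ?_
      refine (mul_le_mul' hZ (ciSup_le' fun z => ?_)).trans (Cardinal.mul_eq_self hκ).le
      exact (Cardinal.lt_aleph0_of_finite _).le.trans hκ
    refine ⟨Z ∪ (fun i => Finsupp.single i 1) '' B, Set.subset_union_left,
      mk_union_le_of_le hκ hZ (Cardinal.mk_image_le.trans hB), A ∪ B, ?_⟩
    rw [Finsupp.supported_union, Submodule.span_union, ← Finsupp.supported_eq_span_single]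
    congr 1
    refine (sup_eq_right.2 (Submodule.span_le.2 fun z hz => ?_)).symm
    exact (Finsupp.mem_supported R z).2
      (Set.subset_iUnion (fun z : Z => (z.1.support : Set ι)) ⟨z, hz⟩)

variable {I J : Type} {M : I → Type u} [∀ i, AddCommGroup (M i)] [∀ i, Module R (M i)]
  {a b : J → I}

/-- A family of submodules `N i ≤ M i` is strict for a family of linear maps `f` if every `f j`
maps `N` into `N`, and every element of `N` in the image of `f j` is the image of an element of
`N`. For the maps of an exact complex this says that `N` is an exact subcomplex, and then the
quotient by `N` is exact as well. -/
def IsStrict (f : ∀ j, M (a j) →ₗ[R] M (b j)) (N : ∀ i, Submodule R (M i)) : Prop :=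
  ∀ j, (N (a j)).map (f j) = N (b j) ⊓ LinearMap.range (f j)

variable {f : ∀ j, M (a j) →ₗ[R] M (b j)}

lemma IsStrict.apply_mem {N : ∀ i, Submodule R (M i)} (h : IsStrict f N) (j : J) {x : M (a j)}
    (hx : x ∈ N (a j)) : f j x ∈ N (b j) :=
  ((h j).le (Submodule.mem_map_of_mem hx)).1

lemma IsStrict.exists_eq {N : ∀ i, Submodule R (M i)} (h : IsStrict f N) (j : J) {x : M (a j)}
    (hx : f j x ∈ N (b j)) : ∃ y ∈ N (a j), f j y = f j x :=
  (h j).ge ⟨hx, x, rfl⟩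

lemma isStrict_iff {N : ∀ i, Submodule R (M i)} : IsStrict f N ↔ ∀ j,
    (∀ x ∈ N (a j), f j x ∈ N (b j)) ∧ ∀ x, f j x ∈ N (b j) → ∃ y ∈ N (a j), f j y = f j x := by
  refine ⟨fun h j => ⟨fun x hx => h.apply_mem j hx, fun x hx => h.exists_eq j hx⟩,
    fun h j => le_antisymm ?_ ?_⟩
  · rintro _ ⟨x, hx, rfl⟩
    exact ⟨(h j).1 x hx, x, rfl⟩
  · rintro _ ⟨hx, x, rfl⟩
    exact (h j).2 x hx

lemma isStrict_bot : IsStrict f ⊥ := fun j => by simp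

lemma mem_sSup_pi_of_isChain {S : Set (∀ i, Submodule R (M i))} (hS : IsChain (· ≤ ·) S)
    (hne : S.Nonempty) (i : I) {x : M i} : x ∈ sSup S i ↔ ∃ N ∈ S, x ∈ N i := by
  have := hne.to_subtype
  rw [sSup_apply, Submodule.mem_iSup_of_directed]
  · simp
  · rintro ⟨N, hN⟩ ⟨N', hN'⟩
    obtain h | h := hS.total hN hN'
    exacts [⟨⟨N', hN'⟩, h i, le_rfl⟩, ⟨⟨N, hN⟩, le_rfl, h i⟩]

lemma isStrict_sSup {S : Set (∀ i, Submodule R (M i))} (hS : IsChain (· ≤ ·) S)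
    (h : ∀ N ∈ S, IsStrict f N) : IsStrict f (sSup S) := by
  obtain rfl | hne := S.eq_empty_or_nonempty
  · rw [sSup_empty]
    exact isStrict_bot
  rw [isStrict_iff]
  simp only [mem_sSup_pi_of_isChain hS hne]
  refine fun j => ⟨?_, ?_⟩
  · rintro x ⟨N, hN, hx⟩
    exact ⟨N, hN, (h N hN).apply_mem j hx⟩
  · rintro x ⟨N, hN, hx⟩
    obtain ⟨y, hy, e⟩ := (h N hN).exists_eq j hx
    exact ⟨y, ⟨N, hN, hy⟩, e⟩

variable [Countable J] {κ : Cardinal.{u}} {G : ∀ i, Set (Submodule R (M i))}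

/-- One closing-up step: given `κ` elements in each `M i`, adjoin their images and one preimage,
modulo `N`, of each of their linear combinations which has one. -/
lemma exists_closure_step (hκ : Cardinal.aleph0 ≤ κ) (hR : Cardinal.mk R ≤ κ)
    (hG : ∀ i, IsAmple κ (G i)) (f : ∀ j, M (a j) →ₗ[R] M (b j)) (N : ∀ i, Submodule R (M i))
    (hN : ∀ i, N i ∈ G i) (T : ∀ i, Set (M i)) (hT : ∀ i, Cardinal.mk (T i) ≤ κ) :
    ∃ T' : ∀ i, Set (M i), (∀ i, T i ⊆ T' i) ∧ (∀ i, Cardinal.mk (T' i) ≤ κ) ∧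
      (∀ i, N i ⊔ Submodule.span R (T' i) ∈ G i) ∧
      (∀ j, ∀ y ∈ Submodule.span R (T (a j)), f j y ∈ T' (b j)) ∧
      ∀ j, ∀ y ∈ Submodule.span R (T (b j)), ∀ z, f j z - y ∈ N (b j) →
        ∃ z' ∈ T' (a j), f j z' - y ∈ N (b j) := by
  classical
  -- a chosen preimage of `y` modulo `N`, if there is one
  let c (j : J) (y : M (b j)) : M (a j) :=
    if h : ∃ z, f j z - y ∈ N (b j) then h.choose else 0
  have hc (j : J) (y : M (b j)) (z) (h : f j z - y ∈ N (b j)) : f j (c j y) - y ∈ N (b j) := by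
    have h' : ∃ z, f j z - y ∈ N (b j) := ⟨z, h⟩
    simp only [c, dif_pos h']
    exact h'.choose_spec
  let U : Set (Σ i, M i) :=
    (⋃ j, (fun y => (⟨b j, f j y⟩ : Σ i, M i)) '' (Submodule.span R (T (a j)) : Set (M (a j)))) ∪
    ⋃ j, (fun y => (⟨a j, c j y⟩ : Σ i, M i)) '' (Submodule.span R (T (b j)) : Set (M (b j)))
  have hU : Cardinal.mk U ≤ κ := mk_union_le_of_le hκ
    (mk_iUnion_le_of_countable hκ _ fun j => Cardinal.mk_image_le.trans
      (mk_span_le_of_le hκ hR (hT _)))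
    (mk_iUnion_le_of_countable hκ _ fun j => Cardinal.mk_image_le.trans
      (mk_span_le_of_le hκ hR (hT _)))
  have hV (i : I) : Cardinal.mk (T i ∪ Sigma.mk i ⁻¹' U : Set (M i)) ≤ κ :=
    mk_union_le_of_le hκ (hT i)
      ((Cardinal.mk_preimage_of_injective _ _ sigma_mk_injective).trans hU)
  choose T' h1 h2 h3 using fun i => (hG i).extend (N i) (hN i) _ (hV i)
  refine ⟨T', fun i => Set.subset_union_left.trans (h1 i), h2, h3, fun j y hy => h1 _ (Or.inr ?_),
    fun j y hy z hz => ⟨c j y, h1 _ (Or.inr ?_), hc j y z hz⟩⟩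
  · exact Or.inl (Set.mem_iUnion.2 ⟨j, y, hy, rfl⟩)
  · exact Or.inr (Set.mem_iUnion.2 ⟨j, y, hy, rfl⟩)

/-- A strict family of submodules from ample sets can be enlarged, by adjoining at most `κ`
generators in each `M i`, to a strict family that contains any `κ` given elements of each `M i`. -/
theorem IsStrict.exists_extension (hκ : Cardinal.aleph0 ≤ κ) (hR : Cardinal.mk R ≤ κ)
    (hG : ∀ i, IsAmple κ (G i)) {N : ∀ i, Submodule R (M i)} (hf : IsStrict f N)
    (hN : ∀ i, N i ∈ G i) (Z : ∀ i, Set (M i)) (hZ : ∀ i, Cardinal.mk (Z i) ≤ κ) :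
    ∃ N' : ∀ i, Submodule R (M i), IsStrict f N' ∧ (∀ i, N' i ∈ G i) ∧ N ≤ N' ∧
      (∀ i, Z i ⊆ N' i) ∧ ∀ i, ∃ T : Set (M i), Cardinal.mk T ≤ κ ∧
        N' i = N i ⊔ Submodule.span R T := by
  choose! next h1 h2 h3 h4 h5 using fun (T : ∀ i, Set (M i)) (hT : ∀ i, Cardinal.mk (T i) ≤ κ) =>
    exists_closure_step hκ hR hG f N hN T hT
  -- countably many closing-up steps suffice, since spans are finitary
  let T (k : ℕ) : ∀ i, Set (M i) := next^[k] Z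
  have hT (k) : ∀ i, Cardinal.mk (T k i) ≤ κ := by
    induction k with
    | zero => exact hZ
    | succ k ih =>
      simp only [T, Function.iterate_succ_apply']
      exact h2 _ ih
  have hTs (k) : T (k + 1) = next (T k) := Function.iterate_succ_apply' _ _ _
  have hmono (i) : Monotone fun k => T k i := monotone_nat_of_le_succ fun k => by
    simp only [hTs]
    exact h1 _ (hT k) i
  have hspan (i) {x : M i} : x ∈ Submodule.span R (⋃ k, T k i) ↔
      ∃ k, x ∈ Submodule.span R (T k i) := by
    rw [Submodule.span_iUnion, Submodule.mem_iSup_of_directed]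
    exact Monotone.directed_le fun _ _ h => Submodule.span_mono (hmono i h)
  refine ⟨fun i => N i ⊔ Submodule.span R (⋃ k, T k i), ?_, fun i => ?_, fun i => le_sup_left,
    fun i => (Set.subset_iUnion (fun k => T k i) 0).trans
      (Submodule.subset_span.trans (SetLike.coe_subset_coe.2 le_sup_right)),
    fun i => ⟨_, mk_iUnion_le_of_countable hκ _ fun k => hT k i, rfl⟩⟩
  · rw [isStrict_iff]
    refine fun j => ⟨fun x hx => ?_, fun x hx => ?_⟩
    · obtain ⟨n, hn, y, hy, rfl⟩ := Submodule.mem_sup.1 hx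
      obtain ⟨k, hk⟩ := (hspan _).1 hy
      rw [map_add]
      refine Submodule.add_mem_sup (hf.apply_mem j hn)
        ((hspan _).2 ⟨k + 1, Submodule.subset_span ?_⟩)
      rw [hTs]
      exact h4 _ (hT k) j y hk
    · obtain ⟨n, hn, y, hy, e⟩ := Submodule.mem_sup.1 hx
      obtain ⟨k, hk⟩ := (hspan _).1 hy
      have hxy : f j x - y ∈ N (b j) := by rwa [← e, add_sub_cancel_right]
      obtain ⟨z, hz, hz'⟩ := h5 _ (hT k) j y hk x hxy
      -- `z` is a preimage modulo `N`, and the error is corrected by strictness of `N`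
      have hxz : f j (x - z) ∈ N (b j) := by
        rw [map_sub, ← sub_sub_sub_cancel_right _ _ y]
        exact sub_mem hxy hz'
      obtain ⟨n', hn', e'⟩ := hf.exists_eq j hxz
      refine ⟨n' + z, Submodule.add_mem_sup hn'
        ((hspan _).2 ⟨k + 1, Submodule.subset_span (by rwa [hTs])⟩), ?_⟩
      rw [map_add, e', map_sub, sub_add_cancel]
  · have : N i ⊔ Submodule.span R (⋃ k, T k i) =
        sSup (Set.range fun k => N i ⊔ Submodule.span R (T (k + 1) i)) := by
      rw [sSup_range, ← sup_iSup, Submodule.span_iUnion]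
      congr 1
      exact (Monotone.iSup_nat_add (f := fun k => Submodule.span R (T k i))
        (fun _ _ h => Submodule.span_mono (hmono i h)) 1).symm
    change N i ⊔ Submodule.span R (⋃ k, T k i) ∈ G i
    rw [this]
    refine (hG i).sSup_mem _ ?_
    rintro _ ⟨k, rfl⟩
    simp only [hTs]
    exact h3 _ (hT k) i

end StrictFamilies

/-! ### Subquotients: projectivity, cardinality and exactness -/

section Subquotients

variable {R : Type u} [Ring R]

lemma projective_finsupp_quotient_supported {ι : Type u} (A : Set ι) :
    Module.Projective R ((ι →₀ R) ⧸ Finsupp.supported R R A) := by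
  classical
  let r : (ι →₀ R) →ₗ[R] (ι →₀ R) :=
    (Finsupp.supported R R Aᶜ).subtype ∘ₗ Finsupp.restrictDom R R Aᶜ
  have hr (x i) : r x i = if i ∈ A then 0 else x i := by
    simp [r, Finsupp.filter_apply, ite_not]
  refine Module.Projective.of_split
    ((Finsupp.supported R R A).liftQ r fun x hx => ?_) (Submodule.mkQ _) ?_
  · ext i
    rw [hr]
    split_ifs with hi
    · rfl
    · exact (Finsupp.mem_supported' R x).1 hx i hi
  · ext i : 3
    refine (Submodule.Quotient.eq _).2 ((Finsupp.mem_supported' R _).2 fun k hk => ?_)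
    rw [Finsupp.sub_apply]
    exact (congrArg (· - _) (hr _ k)).trans (by simp [hk])

/-- A submodule which is compatible with a splitting `P → F → P` and whose companion in `F` has a
projective quotient has a projective quotient. -/
lemma projective_quotient_of_retract {P F : Type u} [AddCommGroup P] [Module R P] [AddCommGroup F]
    [Module R F] (s : P →ₗ[R] F) (p : F →ₗ[R] P) (hps : p ∘ₗ s = LinearMap.id)
    (N : Submodule R P) (K : Submodule R F) (hs : N ≤ K.comap s) (hp : K ≤ N.comap p)
    [Module.Projective R (F ⧸ K)] : Module.Projective R (P ⧸ N) := by
  refine Module.Projective.of_split (N.mapQ K s hs) (K.mapQ N p hp) ?_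
  ext x
  exact congrArg (Submodule.Quotient.mk (p := N)) (LinearMap.congr_fun hps x)

/-- `N' / N` is the kernel of the split surjection `P / N → P / N'`. -/
lemma projective_subquotient {P : Type u} [AddCommGroup P] [Module R P] {N N' : Submodule R P}
    (h : N ≤ N') [Module.Projective R (P ⧸ N)] [Module.Projective R (P ⧸ N')] :
    Module.Projective R (N' ⧸ N.submoduleOf N') := by
  let q : (P ⧸ N) →ₗ[R] P ⧸ N' := N.mapQ N' LinearMap.id h
  let i : (N' ⧸ N.submoduleOf N') →ₗ[R] P ⧸ N := (N.submoduleOf N').mapQ N N'.subtype le_rfl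
  have hi : Function.Injective i := by
    rw [← LinearMap.ker_eq_bot]
    refine (Submodule.ker_mapQ _ _ _ _).trans ?_
    exact Submodule.mkQ_map_self _
  have hr : LinearMap.range i = LinearMap.ker q := by
    refine (Submodule.range_mapQ _ _ _ _).trans (Eq.trans ?_ (Submodule.ker_mapQ _ _ _ _).symm)
    rw [Submodule.range_subtype, Submodule.comap_id]
  obtain ⟨σ, hσ⟩ := Module.projective_lifting_property q LinearMap.id
    (fun y => by
      obtain ⟨x, rfl⟩ := Submodule.Quotient.mk_surjective _ y
      exact ⟨Submodule.Quotient.mk x, rfl⟩)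
  let r : (P ⧸ N) →ₗ[R] LinearMap.range i := (LinearMap.id - σ ∘ₗ q).codRestrict _ fun x => by
    rw [hr, LinearMap.mem_ker]
    simpa [sub_eq_zero] using (LinearMap.congr_fun hσ (q x)).symm
  refine Module.Projective.of_split i ((LinearEquiv.ofInjective i hi).symm ∘ₗ r) ?_
  ext x
  apply (LinearEquiv.ofInjective i hi).injective
  apply Subtype.ext
  have : q (i (Submodule.Quotient.mk x)) = 0 := by
    rw [← LinearMap.mem_ker, ← hr]
    exact ⟨_, rfl⟩
  simp [r, this]

lemma mk_subquotient_le {M : Type u} [AddCommGroup M] [Module R M] {κ : Cardinal.{u}}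
    (hκ : Cardinal.aleph0 ≤ κ) (hR : Cardinal.mk R ≤ κ) {N N' : Submodule R M} {T : Set M}
    (hT : Cardinal.mk T ≤ κ) (h : N' = N ⊔ Submodule.span R T) :
    Cardinal.mk (N' ⧸ N.submoduleOf N') ≤ κ := by
  refine le_trans (Cardinal.mk_le_of_surjective (f := fun x : Submodule.span R T =>
    (Submodule.Quotient.mk ⟨x, h ▸ Submodule.mem_sup_right x.2⟩ : N' ⧸ N.submoduleOf N')) ?_)
    (mk_span_le_of_le hκ hR hT)
  intro y
  obtain ⟨⟨y, hy⟩, rfl⟩ := Submodule.Quotient.mk_surjective _ y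
  obtain ⟨n, hn, t, ht, rfl⟩ := Submodule.mem_sup.1 (h ▸ hy)
  refine ⟨⟨t, ht⟩, ((Submodule.Quotient.eq _).2 ?_).symm⟩
  simpa [Submodule.submoduleOf] using hn

/-- The map induced by `f` on subquotients. -/
def subquotientMap {A B : Type u} [AddCommGroup A] [Module R A] [AddCommGroup B] [Module R B]
    (f : A →ₗ[R] B) {N N' : Submodule R A} {K K' : Submodule R B} (h : ∀ x ∈ N, f x ∈ K)
    (h' : ∀ x ∈ N', f x ∈ K') : (N' ⧸ N.submoduleOf N') →ₗ[R] K' ⧸ K.submoduleOf K' :=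
  Submodule.mapQ _ _ (f.restrict h') fun _ hx => h _ hx

/-- Strictness of the lower submodules for `g` and of the upper ones for `f` makes the subquotients
of an exact sequence exact. -/
lemma exact_subquotientMap {A B C : Type u} [AddCommGroup A] [Module R A] [AddCommGroup B]
    [Module R B] [AddCommGroup C] [Module R C] {f : A →ₗ[R] B} {g : B →ₗ[R] C}
    (hfg : Function.Exact f g) {N N' : Submodule R A} {K K' : Submodule R B}
    {L L' : Submodule R C} (hK : K ≤ K') (h : ∀ x ∈ N, f x ∈ K)
    (h' : ∀ x ∈ N', f x ∈ K') (k : ∀ x ∈ K, g x ∈ L) (k' : ∀ x ∈ K', g x ∈ L')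
    (hs : ∀ x, f x ∈ K' → ∃ y ∈ N', f y = f x) (ks : ∀ x, g x ∈ L → ∃ y ∈ K, g y = g x) :
    Function.Exact (subquotientMap f h h') (subquotientMap g k k') := by
  intro y
  obtain ⟨⟨y, hy⟩, rfl⟩ := Submodule.Quotient.mk_surjective _ y
  constructor
  · intro hy'
    obtain ⟨n, hn, e⟩ := ks y ((Submodule.Quotient.mk_eq_zero (L.submoduleOf L')).1 hy')
    obtain ⟨x, hx⟩ := (hfg (y - n)).1 (by rw [map_sub, e, sub_self])
    obtain ⟨x', hx', e'⟩ := hs x (hx ▸ sub_mem hy (hK hn))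
    refine ⟨Submodule.Quotient.mk ⟨x', hx'⟩, (Submodule.Quotient.eq _).2 ?_⟩
    change f x' - y ∈ K
    rw [e', hx, sub_sub_cancel_left]
    exact neg_mem hn
  · rintro ⟨x, hx⟩
    obtain ⟨⟨x, hx'⟩, rfl⟩ := Submodule.Quotient.mk_surjective _ x
    have hxy : f x - y ∈ K := (Submodule.Quotient.eq (K.submoduleOf K')).1 hx
    refine (Submodule.Quotient.mk_eq_zero (L.submoduleOf L')).2 (?_ : g y ∈ L)
    have := k _ hxy
    rw [map_sub, hfg.apply_apply_eq_zero, zero_sub] at this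
    simpa using this

end Subquotients

/-! ### Exactness in degrees, and subcomplexes -/

section Exactness

variable {R : Type u} [Ring R]

lemma exactAt_iff_function_exact (X : ChainComplex (ModuleCat.{u} R) ℤ) (m : ℤ) :
    X.ExactAt m ↔ Function.Exact (X.d (m + 1) m).hom (X.d m (m - 1)).hom := by
  rw [X.exactAt_iff' (m + 1) m (m - 1) (by simp) (by simp),
    ShortComplex.ShortExact.moduleCat_exact_iff_function_exact]
  rfl

lemma shortExact_of_degreewise {X Y Z : ChainComplex (ModuleCat.{u} R) ℤ} (f : X ⟶ Y) (g : Y ⟶ Z)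
    (h : f ≫ g = 0) (hf : ∀ m, Function.Injective (f.f m).hom)
    (hg : ∀ m, Function.Surjective (g.f m).hom)
    (hfg : ∀ m, Function.Exact (f.f m).hom (g.f m).hom) : (ShortComplex.mk f g h).ShortExact := by
  refine HomologicalComplex.shortExact_of_degreewise_shortExact _ fun m => ?_
  exact { exact := (ShortComplex.ShortExact.moduleCat_exact_iff_function_exact _).2 (hfg m)
          mono_f := (ModuleCat.mono_iff_injective _).2 (hf m)
          epi_g := (ModuleCat.epi_iff_surjective _).2 (hg m) }

namespace Subcomplex

variable {X : ChainComplex (ModuleCat.{u} R) ℤ}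

/-- The inclusion of a subcomplex in a larger one. -/
def inclusion {Y Z : Subcomplex X} (h : ∀ m, Y.carrier m ≤ Z.carrier m) :
    Y.toComplex ⟶ Z.toComplex where
  f m := ModuleCat.ofHom (Submodule.inclusion (h m))

/-- The inclusion of a subcomplex in the ambient complex. -/
def ι (Y : Subcomplex X) : Y.toComplex ⟶ X where
  f m := ModuleCat.ofHom (Y.carrier m).subtype

/-- The projection of a subcomplex onto its quotient by a smaller one. -/
def toQuotientWithin (Y Z : Subcomplex X) : Z.toComplex ⟶ (Y.within Z).quotient where
  f m := ModuleCat.ofHom ((Y.carrier m).submoduleOf (Z.carrier m)).mkQ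

lemma shortExact_within {Y Z : Subcomplex X} (h : ∀ m, Y.carrier m ≤ Z.carrier m) :
    (ShortComplex.mk (inclusion h) (toQuotientWithin Y Z) (by
      ext m x
      exact (Submodule.Quotient.mk_eq_zero _).2 x.2)).ShortExact := by
  refine shortExact_of_degreewise _ _ _ (fun m => Submodule.inclusion_injective (h m))
    (fun m => Submodule.mkQ_surjective _) fun m x => ?_
  refine (Submodule.Quotient.mk_eq_zero _).trans ⟨fun hx => ⟨⟨x.1, hx⟩, rfl⟩, ?_⟩
  rintro ⟨y, rfl⟩
  exact y.2

end Subcomplex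

end Exactness

/-! ### Complexes with resolved terms -/

section ResolvedComplexes

variable {R : Type u} [Ring R]

/-- Labels for the modules attached to a complex with projective resolutions of its terms: the
terms of the complex, the terms of the resolutions, and free modules covering the latter. -/
inductive ResolutionIndex
  | term (m : ℤ)
  | proj (m : ℤ) (k : ℕ)
  | free (m : ℤ) (k : ℕ)

/-- Labels for the maps between these modules: the differentials of the complex, the augmentations
and differentials of the resolutions, and a splitting `proj → free → proj`. -/
inductive ResolutionMap
  | diff (i j : ℤ)
  | aug (m : ℤ)
  | res (m : ℤ) (k : ℕ)
  | sec (m : ℤ) (k : ℕ)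
  | ret (m : ℤ) (k : ℕ)

instance : Countable ResolutionMap := by
  refine Function.Surjective.countable (α := Fin 5 × ℤ × ℤ × ℕ) (f := fun x =>
    match x with
    | (0, i, j, _) => .diff i j
    | (1, m, _, _) => .aug m
    | (2, m, _, k) => .res m k
    | (3, m, _, k) => .sec m k
    | (4, m, _, k) => .ret m k) ?_
  rintro (⟨i, j⟩ | m | ⟨m, k⟩ | ⟨m, k⟩ | ⟨m, k⟩)
  exacts [⟨(0, i, j, 0), rfl⟩, ⟨(1, m, 0, 0), rfl⟩, ⟨(2, m, 0, k), rfl⟩, ⟨(3, m, 0, k), rfl⟩,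
    ⟨(4, m, 0, k), rfl⟩]

namespace ResolutionMap

/-- The source of a map. -/
def source : ResolutionMap → ResolutionIndex
  | diff i _ => .term i
  | aug m => .proj m 0
  | res m k => .proj m (k + 1)
  | sec m k => .proj m k
  | ret m k => .free m k

/-- The target of a map. -/
def target : ResolutionMap → ResolutionIndex
  | diff _ j => .term j
  | aug m => .term m
  | res m k => .proj m k
  | sec m k => .free m k
  | ret m k => .proj m k

end ResolutionMap

variable {n : ℕ} {X : ChainComplex (ModuleCat.{u} R) ℤ} (r : ∀ m, ProjResOfLength n (X.X m))

/-- The module with a given label. -/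
noncomputable def resolutionModule : ResolutionIndex → ModuleCat.{u} R
  | .term m => X.X m
  | .proj m k => (r m).P k
  | .free m k => ModuleCat.of R ((r m).P k →₀ R)

lemma exists_finsupp_section (m : ℤ) (k : ℕ) : ∃ s : (r m).P k →ₗ[R] ((r m).P k →₀ R),
    Finsupp.linearCombination R id ∘ₗ s = LinearMap.id :=
  Module.projective_def'.1 ((r m).projective k)

/-- The map with a given label. -/
noncomputable def resolutionMap : ∀ j : ResolutionMap,
    resolutionModule r j.source →ₗ[R] resolutionModule r j.target
  | .diff i j => (X.d i j).hom
  | .aug m => (r m).aug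
  | .res m k => (r m).d k
  | .sec m k => (exists_finsupp_section r m k).choose
  | .ret m k => (Finsupp.linearCombination R id : ((r m).P k →₀ R) →ₗ[R] (r m).P k)

/-- The admissible submodules: those spanned by basis elements in the free modules, and all
submodules of the other modules. -/
def resolutionAdmissible : ∀ i, Set (Submodule R (resolutionModule r i))
  | .term _ => Set.univ
  | .proj _ _ => Set.univ
  | .free m k =>
    Set.range (Finsupp.supported R R : Set ((r m).P k) → Submodule R ((r m).P k →₀ R))

lemma isAmple_resolutionAdmissible {κ : Cardinal.{u}} (hκ : Cardinal.aleph0 ≤ κ) :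
    ∀ i, IsAmple κ (resolutionAdmissible r i)
  | .term _ => isAmple_univ κ
  | .proj _ _ => isAmple_univ κ
  | .free _ _ => isAmple_supported hκ

/-- A strict family of admissible submodules. Its members are exact subcomplexes, of the complex
and of the resolutions, and the quotients of the resolutions by them have projective terms. -/
structure IsGoodFamily (N : ∀ i, Submodule R (resolutionModule r i)) : Prop where
  strict : IsStrict (resolutionMap r) N
  mem : ∀ i, N i ∈ resolutionAdmissible r i

namespace IsGoodFamily

variable {r}

lemma sSup {S : Set (∀ i, Submodule R (resolutionModule r i))} (hS : IsChain (· ≤ ·) S)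
    (h : ∀ N ∈ S, IsGoodFamily r N) : IsGoodFamily r (sSup S) where
  strict := isStrict_sSup hS fun N hN => (h N hN).strict
  mem i := by
    rw [sSup_apply, ← sSup_range]
    refine (isAmple_resolutionAdmissible r le_rfl i).sSup_mem _ ?_
    rintro _ ⟨N, rfl⟩
    exact (h N N.2).mem i

lemma bot : IsGoodFamily r ⊥ := by
  rw [← sSup_empty]
  exact .sSup Set.subsingleton_empty.isChain (by simp)

variable {N N' : ∀ i, Submodule R (resolutionModule r i)}

lemma term_strict (h : IsGoodFamily r N) (i j : ℤ) :
    (∀ x ∈ N (.term i), (X.d i j).hom x ∈ N (.term j)) ∧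
    ∀ x, (X.d i j).hom x ∈ N (.term j) → ∃ y ∈ N (.term i), (X.d i j).hom y = (X.d i j).hom x :=
  isStrict_iff.1 h.strict (.diff i j)

lemma aug_strict (h : IsGoodFamily r N) (m : ℤ) :
    (∀ x ∈ N (.proj m 0), (r m).aug x ∈ N (.term m)) ∧
    ∀ x, (r m).aug x ∈ N (.term m) → ∃ y ∈ N (.proj m 0), (r m).aug y = (r m).aug x :=
  isStrict_iff.1 h.strict (.aug m)

lemma res_strict (h : IsGoodFamily r N) (m : ℤ) (k : ℕ) :
    (∀ x ∈ N (.proj m (k + 1)), (r m).d k x ∈ N (.proj m k)) ∧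
    ∀ x, (r m).d k x ∈ N (.proj m k) → ∃ y ∈ N (.proj m (k + 1)), (r m).d k y = (r m).d k x :=
  isStrict_iff.1 h.strict (.res m k)

lemma projective_quotient (h : IsGoodFamily r N) (m : ℤ) (k : ℕ) :
    Module.Projective R (resolutionModule r (.proj m k) ⧸ N (.proj m k)) := by
  let K : Submodule R ((r m).P k →₀ R) := N (.free m k)
  have : Module.Projective R (((r m).P k →₀ R) ⧸ K) := by
    obtain ⟨A, hA⟩ := h.mem (.free m k)
    change Finsupp.supported R R A = K at hA
    rw [← hA]
    exact projective_finsupp_quotient_supported A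
  exact projective_quotient_of_retract _ _ (exists_finsupp_section r m k).choose_spec _ K
    (fun x hx => h.strict.apply_mem (.sec m k) hx) (fun x hx => h.strict.apply_mem (.ret m k) hx)

/-- The subcomplex formed by the terms of a good family. -/
def subcomplex (h : IsGoodFamily r N) : Subcomplex X where
  carrier m := N (.term m)
  map_d i j := (h.term_strict i j).1

/-- The subquotient of two good families is an exact complex whose terms are resolved by the
subquotients of the resolutions. -/
lemma exTilde_quotient {κ : Cardinal.{u}} (hκ : Cardinal.aleph0 ≤ κ) (hR : Cardinal.mk R ≤ κ)
    (hX : ∀ m, X.ExactAt m) (h : IsGoodFamily r N) (h' : IsGoodFamily r N') (hle : N ≤ N')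
    (hT : ∀ i, ∃ T : Set (resolutionModule r i), Cardinal.mk T ≤ κ ∧
      N' i = N i ⊔ Submodule.span R T) :
    exTilde (smallNProjective R n κ) (h.subcomplex.within h'.subcomplex).quotient := by
  refine ⟨fun m => ?_, fun m => ?_⟩
  · rw [exactAt_iff_function_exact]
    exact exact_subquotientMap ((exactAt_iff_function_exact X m).1 (hX m)) (hle (.term m))
      (h.term_strict _ _).1 (h'.term_strict _ _).1 (h.term_strict _ _).1 (h'.term_strict _ _).1
      (h'.term_strict _ _).2 (h.term_strict _ _).2
  · refine ⟨{ P := fun k => ModuleCat.of R (N' (.proj m k) ⧸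
                (N (.proj m k)).submoduleOf (N' (.proj m k)))
              d := fun k => subquotientMap ((r m).d k) (h.res_strict m k).1 (h'.res_strict m k).1
              aug := subquotientMap (r m).aug (h.aug_strict m).1 (h'.aug_strict m).1
              projective := fun k => ?_
              subsingleton := fun k hk => ?_
              exact_succ := fun k => ?_
              exact_zero := ?_
              surjective := ?_ }, fun k => ?_⟩
    · have := h.projective_quotient m k
      have := h'.projective_quotient m k
      exact projective_subquotient (hle (.proj m k))
    · have : Subsingleton (resolutionModule r (.proj m k)) := (r m).subsingleton k hk
      have : Subsingleton (N' (.proj m k)) := Subtype.val_injective.subsingleton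
      exact (Submodule.mkQ_surjective _).subsingleton
    · exact exact_subquotientMap ((r m).exact_succ k) (hle (.proj m (k + 1)))
        (h.res_strict m (k + 1)).1 (h'.res_strict m (k + 1)).1 (h.res_strict m k).1
        (h'.res_strict m k).1 (h'.res_strict m (k + 1)).2 (h.res_strict m k).2
    · exact exact_subquotientMap (r m).exact_zero (hle (.proj m 0))
        (h.res_strict m 0).1 (h'.res_strict m 0).1 (h.aug_strict m).1
        (h'.aug_strict m).1 (h'.res_strict m 0).2 (h.aug_strict m).2
    · intro y
      obtain ⟨⟨y, hy⟩, rfl⟩ := Submodule.Quotient.mk_surjective _ y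
      obtain ⟨x, rfl⟩ := (r m).surjective y
      obtain ⟨x', hx', e⟩ := (h'.aug_strict m).2 x hy
      exact ⟨Submodule.Quotient.mk ⟨x', hx'⟩, congrArg Submodule.Quotient.mk (Subtype.ext e)⟩
    · obtain ⟨T, hT, e⟩ := hT (.proj m k)
      exact mk_subquotient_le hκ hR hT e

/-- A proper good family has a strictly larger good family, with small quotient. -/
lemma exists_lt {κ : Cardinal.{u}} (hκ : Cardinal.aleph0 ≤ κ) (hR : Cardinal.mk R ≤ κ)
    (h : IsGoodFamily r N) : ∃ N', IsGoodFamily r N' ∧ N ≤ N' ∧ (N ≠ ⊤ → N < N') ∧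
      ∀ i, ∃ T : Set (resolutionModule r i), Cardinal.mk T ≤ κ ∧
        N' i = N i ⊔ Submodule.span R T := by
  have hz (i) : ∃ z, N i ≠ ⊤ → z ∉ N i := by
    by_cases hi : N i = ⊤
    · exact ⟨0, fun h => absurd hi h⟩
    · obtain ⟨z, hz⟩ := SetLike.exists_not_mem_of_ne_top _ hi
      exact ⟨z, fun _ => hz⟩
  choose z hz using hz
  obtain ⟨N', h1, h2, h3, h4, h5⟩ := h.strict.exists_extension hκ hR
    (isAmple_resolutionAdmissible r hκ) h.mem (fun i => {z i})
    (fun i => (Cardinal.mk_singleton _).le.trans (Cardinal.one_le_aleph0.trans hκ))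
  refine ⟨N', ⟨h1, h2⟩, h3, fun hne => lt_of_le_of_ne h3 fun e => ?_, h5⟩
  obtain ⟨i, hi⟩ := Function.ne_iff.1 hne
  exact hz i hi (by simpa [e] using h4 i)

end IsGoodFamily

end ResolvedComplexes

/-! ### The filtration -/

section Filtration

variable {R : Type u} [Ring R]

lemma smallNProjective_of_subsingleton (n : ℕ) {κ : Cardinal.{u}} (hκ : Cardinal.aleph0 ≤ κ)
    (M : ModuleCat.{u} R) [Subsingleton M] : smallNProjective R n κ M :=
  ⟨{ P := fun _ => ModuleCat.of R PUnit
     d := fun _ => 0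
     aug := 0
     projective := fun _ => inferInstanceAs (Module.Projective R PUnit.{u + 1})
     subsingleton := fun _ _ => inferInstanceAs (Subsingleton PUnit.{u + 1})
     exact_succ := fun _ _ => by simp
     exact_zero := fun x => by simp
     surjective := fun y => ⟨0, Subsingleton.elim _ _⟩ },
    fun _ => (Cardinal.mk_punit.{u}).le.trans (Cardinal.one_le_aleph0.trans hκ)⟩

lemma exTilde_of_subsingleton (n : ℕ) {κ : Cardinal.{u}} (hκ : Cardinal.aleph0 ≤ κ)
    (X : ChainComplex (ModuleCat.{u} R) ℤ) (h : ∀ m, Subsingleton (X.X m)) :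
    exTilde (smallNProjective R n κ) X :=
  ⟨fun m => (exactAt_iff_function_exact X m).2 fun x =>
    ⟨fun _ => ⟨0, Subsingleton.elim _ _⟩, fun _ => by rw [Subsingleton.elim x 0, map_zero]⟩,
    fun m => smallNProjective_of_subsingleton n hκ _⟩

variable {n : ℕ} {X : ChainComplex (ModuleCat.{u} R) ℤ} {r : ∀ m, ProjResOfLength n (X.X m)}

lemma isGoodFamily_transfiniteIterate
    {φ : (∀ i, Submodule R (resolutionModule r i)) → ∀ i, Submodule R (resolutionModule r i)}
    (hφ : ∀ N, N ≤ φ N) (h : ∀ N, IsGoodFamily r N → IsGoodFamily r (φ N)) (α : Ordinal.{u}) :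
    IsGoodFamily r (transfiniteIterate φ α ⊥) := by
  induction α using SuccOrder.limitRecOn with
  | isMin α hα =>
    obtain rfl := hα.eq_bot
    rw [transfiniteIterate_bot]
    exact .bot
  | succ α hα ih =>
    rw [transfiniteIterate_succ _ _ _ hα]
    exact h _ ih
  | isSuccLimit α hα ih =>
    rw [transfiniteIterate_limit _ _ _ hα, ← sSup_range]
    refine .sSup ?_ ?_
    · exact ((monotone_transfiniteIterate φ ⊥ hφ).comp
        (Subtype.mono_coe (· ∈ Set.Iio α))).isChain_range
    · rintro _ ⟨β, rfl⟩
      exact ih β β.2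

/-- Iterating transfinitely the enlargement of good families exhausts the complex. -/
theorem hasFiltration_of_exTilde {κ : Cardinal.{u}} (hκ : Cardinal.aleph0 ≤ κ)
    (hR : Cardinal.mk R ≤ κ) (hX : exTilde (nProjective R n) X) :
    HasFiltration (exTilde (smallNProjective R n κ)) X := by
  let r := fun m => (hX.2 m).some
  -- the value at families which are not good is irrelevant, but `φ` must be inflationary everywhere
  have hstep (N : ∀ i, Submodule R (resolutionModule r i)) : ∃ N', N ≤ N' ∧ (N ≠ ⊤ → N < N') ∧
      (IsGoodFamily r N → IsGoodFamily r N' ∧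
        ∀ i, ∃ T : Set (resolutionModule r i), Cardinal.mk T ≤ κ ∧
          N' i = N i ⊔ Submodule.span R T) := by
    by_cases h : IsGoodFamily r N
    · obtain ⟨N', h1, h2, h3, h4⟩ := h.exists_lt hκ hR
      exact ⟨N', h2, h3, fun _ => ⟨h1, h4⟩⟩
    · exact ⟨⊤, le_top, fun hne => lt_top_iff_ne_top.2 hne, fun h' => absurd h' h⟩
  choose φ h1 h2 h3 using hstep
  let F (α : Ordinal.{u}) := transfiniteIterate φ α ⊥
  have hF (α) : IsGoodFamily r (F α) :=
    isGoodFamily_transfiniteIterate h1 (fun N hN => (h3 N hN).1) α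
  have hmono : Monotone F := monotone_transfiniteIterate φ ⊥ h1
  obtain ⟨α, hα⟩ : ∃ α, F α = ⊤ := top_mem_range_transfiniteIterate φ ⊥ h2
    (top_le_iff.1 (h1 ⊤)) (not_injective_of_ordinal _)
  have hsucc (β) : F (Order.succ β) = φ (F β) := transfiniteIterate_succ _ _ _ (not_isMax β)
  refine ⟨Order.succ α, fun β => (hF β).subcomplex, ?_⟩
  have hzero : F 0 = ⊥ := transfiniteIterate_bot φ ⊥
  have hzero' (m) : (hF 0).subcomplex.carrier m = ⊥ := congrFun hzero (.term m)
  refine { pos := Order.bot_lt_succ α, zero := hzero', mono := fun β γ h _ m => hmono h (.term m)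
           limit := fun β _ hβ m x hx => ?_
           union := fun m x => ⟨α, Order.lt_succ α, ?_⟩
           mem_zero := ?_, mem_succ := fun β _ => ?_ }
  · have e : F β = sSup (F '' Set.Iio β) := by
      rw [sSup_image']
      exact transfiniteIterate_limit φ ⊥ β hβ
    change x ∈ F β (.term m) at hx
    rw [e] at hx
    obtain ⟨_, ⟨γ, hγ, rfl⟩, hx⟩ := (mem_sSup_pi_of_isChain
      (hmono.isChain_image (isChain_of_trichotomous _)) (hβ.nonempty_Iio.image F) _).1 hx
    exact ⟨γ, hγ, hx⟩
  · change x ∈ F α (.term m)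
    rw [hα]
    trivial
  · refine ObjectProperty.le_isoClosure _ _ (exTilde_of_subsingleton n hκ _ fun m => ?_)
    exact (Submodule.subsingleton_iff_eq_bot).2 (hzero' m)
  · refine ObjectProperty.le_isoClosure _ _ ((hF β).exTilde_quotient hκ hR hX.1 (hF _) ?_ ?_)
    · exact hmono (Order.le_succ β)
    · rw [hsucc]
      exact (h3 _ (hF β)).2

end Filtration

/-! ### Extending lifts along good families -/

section Eklof

lemma mem_prod_sSup_of_isChain {R : Type u} [Ring R] {I J : Type} {M : I → Type u} {M' : J → Type u}
    [∀ i, AddCommGroup (M i)] [∀ i, Module R (M i)] [∀ j, AddCommGroup (M' j)]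
    [∀ j, Module R (M' j)] {S : Set ((∀ i, Submodule R (M i)) × ∀ j, Submodule R (M' j))}
    (hS : IsChain (· ≤ ·) S) (hne : S.Nonempty) :
    (∀ i (x : M i), x ∈ (sSup S).1 i ↔ ∃ q ∈ S, x ∈ q.1 i) ∧
      ∀ j (x : M' j), x ∈ (sSup S).2 j ↔ ∃ q ∈ S, x ∈ q.2 j := by
  refine ⟨fun i x => ?_, fun j x => ?_⟩
  · rw [Prod.fst_sSup, mem_sSup_pi_of_isChain (monotone_fst.isChain_image hS) (hne.image _),
      Set.exists_mem_image]
  · rw [Prod.snd_sSup, mem_sSup_pi_of_isChain (monotone_snd.isChain_image hS) (hne.image _),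
      Set.exists_mem_image]

variable {R : Type u} [Ring R] {n : ℕ} {X : ChainComplex (ModuleCat.{u} R) ℤ}
  {r : ∀ m, ProjResOfLength n (X.X m)}

/-- `W` is the graph of a morphism from the subcomplex with terms `N m` of `X` to `E` which
lifts `g : X ⟶ D` along `p : E ⟶ D`. -/
structure IsLiftGraph {E D : ChainComplex (ModuleCat.{u} R) ℤ} (p : E ⟶ D) (g : X ⟶ D)
    (N : ∀ m, Submodule R (X.X m)) (W : ∀ m, Submodule R (X.X m × E.X m)) : Prop where
  dom : ∀ m x, x ∈ N m ↔ ∃ e, (x, e) ∈ W m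
  fac : ∀ m x e, (x, e) ∈ W m → (p.f m).hom e = (g.f m).hom x
  d_mem : ∀ i j x e, (x, e) ∈ W i → ((X.d i j).hom x, (E.d i j).hom e) ∈ W j
  eq_zero : ∀ m e, (0, e) ∈ W m → e = 0

lemma IsLiftGraph.exists_hom {E D : ChainComplex (ModuleCat.{u} R) ℤ} {p : E ⟶ D} {g : X ⟶ D}
    {N : Subcomplex X} {W : ∀ m, Submodule R (X.X m × E.X m)} (h : IsLiftGraph p g N.carrier W) :
    ∃ u : N.toComplex ⟶ E, u ≫ p = N.ι ≫ g ∧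
      ∀ m x e, (x, e) ∈ W m → ∃ hx : x ∈ N.carrier m, (u.f m).hom ⟨x, hx⟩ = e := by
  choose u hu using fun m (x : N.carrier m) => (h.dom m x).1 x.2
  have huniq (m) (x : N.carrier m) (e) (he : (x.1, e) ∈ W m) : u m x = e := by
    rw [← sub_eq_zero]
    exact h.eq_zero m _ (by simpa using sub_mem (hu m x) he)
  let v (m) : N.carrier m →ₗ[R] E.X m :=
    { toFun := u m
      map_add' := fun x y => huniq m _ _ (add_mem (hu m x) (hu m y))
      map_smul' := fun c x => huniq m _ _ ((W m).smul_mem c (hu m x)) }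
  refine ⟨{ f := fun m => ModuleCat.ofHom (v m), comm' := fun i j _ => ?_ }, ?_, ?_⟩
  · ext x
    exact (huniq j _ _ (h.d_mem i j _ _ (hu i x))).symm
  · ext m x
    exact h.fac m _ _ (hu m x)
  · exact fun m x e he => ⟨(h.dom m x).2 ⟨e, he⟩, huniq m _ _ he⟩

lemma isLiftGraph_sSup {E D : ChainComplex (ModuleCat.{u} R) ℤ} {p : E ⟶ D} {g : X ⟶ D}
    {S : Set ((∀ i, Submodule R (resolutionModule r i)) × ∀ m, Submodule R (X.X m × E.X m))}
    (hS : IsChain (· ≤ ·) S)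
    (h : ∀ q ∈ S, IsLiftGraph p g (fun m => q.1 (.term m)) q.2) :
    IsLiftGraph p g (fun m => (sSup S).1 (.term m)) (sSup S).2 := by
  obtain rfl | hne := S.eq_empty_or_nonempty
  · rw [sSup_empty]
    refine ⟨fun m x => ?_, fun m x e hx => ?_, fun i j x e hx => ?_, fun m e hx => ?_⟩
    · constructor
      · rintro hx
        obtain rfl : x = 0 := hx
        exact ⟨0, rfl⟩
      · rintro ⟨e, hx⟩
        exact congrArg Prod.fst (hx : (x, e) = 0)
    all_goals
      cases (hx : (_, e) = 0)
      simp
  · obtain ⟨h1, h2⟩ := mem_prod_sSup_of_isChain hS hne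
    constructor
    · intro m x
      simp only [h2]
      refine (h1 (.term m) x).trans ⟨?_, ?_⟩
      · rintro ⟨q, hq, hx⟩
        obtain ⟨e, he⟩ := ((h q hq).dom m x).1 hx
        exact ⟨e, q, hq, he⟩
      · rintro ⟨e, q, hq, he⟩
        exact ⟨q, hq, ((h q hq).dom m x).2 ⟨e, he⟩⟩
    · intro m x e hx
      obtain ⟨q, hq, hx⟩ := (h2 _ _).1 hx
      exact (h q hq).fac m x e hx
    · intro i j x e hx
      obtain ⟨q, hq, hx⟩ := (h2 _ _).1 hx
      exact (h2 _ _).2 ⟨q, hq, (h q hq).d_mem i j x e hx⟩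
    · intro m e hx
      obtain ⟨q, hq, hx⟩ := (h2 _ _).1 hx
      exact (h q hq).eq_zero m e hx

/-- A complex orthogonal to the small complexes is orthogonal to all of `exTilde (nProjective R n)`:
a lift defined on the subcomplex of a good family extends to a larger good family, because the
subquotient is small, so by Zorn's lemma there is a lift defined everywhere. -/
theorem rightPerp_small_le {κ : Cardinal.{u}} (hκ : Cardinal.aleph0 ≤ κ)
    (hR : Cardinal.mk R ≤ κ) : rightPerp.{u + 1, u, u} (exTilde (smallNProjective R n κ)) ≤
      rightPerp.{u + 1, u, u} (exTilde (nProjective R n)) := by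
  intro Y hY X hX
  let r := fun m => (hX.2 m).some
  have hs : (ShortComplex.mk _ _ (Limits.cokernel.condition (Injective.ι Y))).ShortExact :=
    { exact := ShortComplex.exact_cokernel _ }
  refine subsingleton_ext_of_lift hs (Ext.subsingleton_of_injective _ _ 0) fun g => ?_
  -- a maximal pair of a good family and the graph of a lift on its subcomplex
  obtain ⟨⟨N, W⟩, hmax⟩ := zorn_le₀ {q : (∀ i, Submodule R (resolutionModule r i)) ×
      ∀ m, Submodule R (X.X m × (Injective.under Y).X m) | IsGoodFamily r q.1 ∧
      IsLiftGraph (Limits.cokernel.π (Injective.ι Y)) g (fun m => q.1 (.term m)) q.2}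
    (fun S hS hc => ⟨sSup S, ⟨Prod.fst_sSup S ▸ .sSup (monotone_fst.isChain_image hc) (by
      rintro _ ⟨q, hq, rfl⟩
      exact (hS hq).1),
      isLiftGraph_sSup hc fun q hq => (hS hq).2⟩, fun q hq => le_sSup hq⟩)
  obtain ⟨hN, hW⟩ := hmax.prop
  obtain ⟨u, hu, hu'⟩ := IsLiftGraph.exists_hom (N := hN.subcomplex) hW
  have htop : N = ⊤ := by
    by_contra hne
    obtain ⟨N', hN', hle, hlt, hT⟩ := hN.exists_lt hκ hR
    have hle' (m) : hN.subcomplex.carrier m ≤ hN'.subcomplex.carrier m := hle (.term m)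
    have hlift := hasLiftingProperty_of_subsingleton_ext (Subcomplex.shortExact_within hle') hs
      (hY _ (hN.exTilde_quotient hκ hR hX.1 hN' hle hT))
    have sq : CommSq u (Subcomplex.inclusion hle') (Limits.cokernel.π (Injective.ι Y))
      (hN'.subcomplex.ι ≫ g) := ⟨by rw [hu]; rfl⟩
    let w : hN'.subcomplex.toComplex ⟶ Injective.under Y := (hlift.sq_hasLift sq).exists_lift.some.l
    have hw : Subcomplex.inclusion hle' ≫ w = u := (hlift.sq_hasLift sq).exists_lift.some.fac_left
    have hwp : w ≫ Limits.cokernel.π (Injective.ι Y) = hN'.subcomplex.ι ≫ g :=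
      (hlift.sq_hasLift sq).exists_lift.some.fac_right
    let W' (m) : Submodule R (X.X m × (Injective.under Y).X m) :=
      LinearMap.range ((hN'.subcomplex.carrier m).subtype.prod (w.f m).hom)
    have hW' : IsLiftGraph (Limits.cokernel.π (Injective.ι Y)) g (fun m => N' (.term m)) W' := by
      refine ⟨fun m x => ⟨fun hx => ⟨_, ⟨x, hx⟩, rfl⟩, ?_⟩, ?_, ?_, ?_⟩
      · rintro ⟨e, y, hy⟩
        obtain rfl : y.1 = x := congrArg Prod.fst hy
        exact y.2
      · rintro m x e ⟨y, hy⟩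
        obtain ⟨rfl, rfl⟩ := Prod.ext_iff.1 hy
        exact LinearMap.congr_fun (congrArg (fun f => (f.f m).hom) hwp) y
      · rintro i j x e ⟨y, hy⟩
        obtain ⟨rfl, rfl⟩ := Prod.ext_iff.1 hy
        refine ⟨(hN'.subcomplex.toComplex.d i j).hom y, Prod.ext rfl ?_⟩
        exact LinearMap.congr_fun (congrArg (fun f => f.hom) (w.comm i j).symm) y
      · rintro m e ⟨y, hy⟩
        obtain rfl : y = 0 := Subtype.ext (congrArg Prod.fst hy)
        exact (congrArg Prod.snd hy).symm.trans (map_zero _)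
    refine (hlt hne).not_ge (hmax.le_of_ge (y := (N', W')) ⟨hN', hW'⟩ ⟨hle, fun m => ?_⟩).1
    rintro ⟨x, e⟩ hx
    obtain ⟨hx', rfl⟩ := hu' m x e hx
    exact ⟨⟨x, hle' m hx'⟩, Prod.ext rfl
      (LinearMap.congr_fun (congrArg (fun f => (f.f m).hom) hw) ⟨x, hx'⟩)⟩
  let t : X ⟶ hN.subcomplex.toComplex :=
    { f := fun m => ModuleCat.ofHom (LinearMap.id.codRestrict _ fun x => by
        change x ∈ N (.term m)
        rw [htop]
        trivial) }
  exact ⟨t ≫ u, by rw [Category.assoc, hu]; rfl⟩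

end Eklof

/-! ### Resolutions of length `n` and projective dimension -/

section Modules

variable {R : Type u} [Ring R]

/-- Splicing a resolution of the kernel of a projective cover. -/
lemma nProjective_succ {n : ℕ} {K P M : ModuleCat.{u} R} (f : K →ₗ[R] P) (g : P →ₗ[R] M)
    (hf : Function.Injective f) (hg : Function.Surjective g) (hfg : Function.Exact f g)
    (hP : Module.Projective R P) (h : nProjective R n K) : nProjective R (n + 1) M := by
  obtain ⟨r⟩ := h
  exact ⟨{
    P := fun k => match k with
      | 0 => P
      | k + 1 => r.P k
    d := fun k => match k with
      | 0 => f ∘ₗ r.aug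
      | k + 1 => r.d k
    aug := g
    projective := fun k => match k with
      | 0 => hP
      | k + 1 => r.projective k
    subsingleton := fun k hk => match k with
      | 0 => absurd hk (by simp)
      | k + 1 => r.subsingleton k (by simpa using hk)
    exact_succ := fun k => match k with
      | 0 => r.exact_zero.comp_injective f hf (map_zero f)
      | k + 1 => r.exact_succ k
    exact_zero := fun x => by
      rw [hfg x]
      change _ ↔ x ∈ Set.range (f ∘ r.aug)
      rw [r.surjective.range_comp]
    surjective := hg }⟩

lemma nProjective_zero_of_projective (M : ModuleCat.{u} R) (hM : Module.Projective R M) :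
    nProjective R 0 M :=
  ⟨{ P := fun k => match k with
       | 0 => M
       | _ + 1 => ModuleCat.of R PUnit
     d := fun _ => 0
     aug := LinearMap.id
     projective := fun k => match k with
       | 0 => hM
       | _ + 1 => inferInstanceAs (Module.Projective R PUnit.{u + 1})
     subsingleton := fun k hk => match k with
       | 0 => absurd hk (by simp)
       | _ + 1 => inferInstanceAs (Subsingleton PUnit.{u + 1})
     exact_succ := fun k (x : PUnit) => by simp
     exact_zero := fun (x : M) => by simp [eq_comm]
     surjective := fun x => ⟨x, rfl⟩ }⟩

lemma shortExact_moduleCat {K P M : ModuleCat.{u} R} (f : K ⟶ P) (g : P ⟶ M) (h : f ≫ g = 0)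
    (hf : Function.Injective f.hom) (hg : Function.Surjective g.hom)
    (hfg : Function.Exact f.hom g.hom) : (ShortComplex.mk f g h).ShortExact where
  exact := (ShortComplex.ShortExact.moduleCat_exact_iff_function_exact _).2 hfg
  mono_f := (ModuleCat.mono_iff_injective _).2 hf
  epi_g := (ModuleCat.epi_iff_surjective _).2 hg

/-- Dimension shifting along `0 → ker aug → P 0 → M → 0`. -/
lemma hasProjectiveDimensionLE_of_nProjective {n : ℕ} {M : ModuleCat.{u} R}
    (h : nProjective R n M) : HasProjectiveDimensionLE M n := by
  induction n generalizing M with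
  | zero =>
    obtain ⟨r⟩ := h
    have := r.subsingleton 1 one_pos
    have hinj : Function.Injective r.aug := by
      refine (injective_iff_map_eq_zero _).2 fun x hx => ?_
      obtain ⟨y, rfl⟩ := (r.exact_zero x).1 hx
      rw [Subsingleton.elim y 0, map_zero]
    have := r.projective 0
    have := Module.Projective.of_equiv (LinearEquiv.ofBijective r.aug ⟨hinj, r.surjective⟩)
    rw [← projective_iff_hasProjectiveDimensionLE_zero]
    exact (IsProjective.iff_projective M).1 this
  | succ n ih =>
    obtain ⟨r⟩ := h
    have hK : nProjective R n (ModuleCat.of R (LinearMap.ker r.aug)) :=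
      ⟨{ P := fun k => r.P (k + 1)
         d := fun k => r.d (k + 1)
         aug := (r.d 0).codRestrict _ fun x => r.exact_zero.apply_apply_eq_zero x
         projective := fun k => r.projective (k + 1)
         subsingleton := fun k hk => r.subsingleton (k + 1) (by lia)
         exact_succ := fun k => r.exact_succ (k + 1)
         exact_zero := fun x => by
           rw [← r.exact_succ 0 x, ← Subtype.coe_inj]
           rfl
         surjective := fun x => by
           obtain ⟨y, hy⟩ := (r.exact_zero x.1).1 x.2
           exact ⟨y, Subtype.ext hy⟩ }⟩
    have hs := shortExact_moduleCat (K := ModuleCat.of R (LinearMap.ker r.aug))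
      (ModuleCat.ofHom (LinearMap.ker r.aug).subtype)
      (ModuleCat.ofHom r.aug) (by ext x; exact x.2) Subtype.val_injective r.surjective
      (LinearMap.exact_subtype_ker_map _)
    exact (hs.hasProjectiveDimensionLT_X₃_iff n
      ((IsProjective.iff_projective _).1 (r.projective 0))).2 (ih hK)

lemma nProjective_of_hasProjectiveDimensionLE {n : ℕ} {M : ModuleCat.{u} R}
    (h : HasProjectiveDimensionLE M n) : nProjective R n M := by
  induction n generalizing M with
  | zero =>
    rw [← projective_iff_hasProjectiveDimensionLE_zero] at h
    exact nProjective_zero_of_projective M ((IsProjective.iff_projective M).2 h)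
  | succ n ih =>
    let g : (M →₀ R) →ₗ[R] M := Finsupp.linearCombination R id
    have hg : Function.Surjective g := Finsupp.linearCombination_id_surjective R M
    have hs := shortExact_moduleCat (K := ModuleCat.of R (LinearMap.ker g))
      (P := ModuleCat.of R (M →₀ R)) (ModuleCat.ofHom (LinearMap.ker g).subtype)
      (ModuleCat.ofHom g) (by ext x; exact x.2) Subtype.val_injective hg
      (LinearMap.exact_subtype_ker_map _)
    have hP : Module.Projective R (M →₀ R) := inferInstance
    refine nProjective_succ (K := ModuleCat.of R (LinearMap.ker g))
      (P := ModuleCat.of R (M →₀ R)) (LinearMap.ker g).subtype g Subtype.val_injective hg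
      (LinearMap.exact_subtype_ker_map _) hP (ih ?_)
    exact (hs.hasProjectiveDimensionLT_X₃_iff n ((IsProjective.iff_projective _).1 hP)).1 h

lemma subsingleton_ext_succ_iff {C : Type u} [Category.{v} C] [Abelian C] [HasExt.{w} C] (M : C)
    {S : ShortComplex C} (hS : S.ShortExact) [Injective S.X₂] (n : ℕ) :
    Subsingleton (Ext.{w} M S.X₁ (n + 2)) ↔ Subsingleton (Ext.{w} M S.X₃ (n + 1)) := by
  refine ⟨fun h => subsingleton_of_forall_eq 0 fun x => ?_,
    fun h => subsingleton_of_forall_eq 0 fun x => ?_⟩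
  · obtain ⟨y, rfl⟩ := Ext.covariant_sequence_exact₃ M hS x (n₁ := n + 2) rfl
      (Subsingleton.elim _ _)
    rw [y.eq_zero_of_injective, Ext.zero_comp]
  · obtain ⟨y, rfl⟩ := Ext.covariant_sequence_exact₁ M hS x (Ext.eq_zero_of_injective _)
      (n₀ := n + 1) rfl
    rw [Subsingleton.elim y 0, Ext.zero_comp]

/-- The `n`-th cosyzygy of `K` represents the vanishing of `Ext^{n+1}(-, K)`. -/
lemma exists_cosyzygy {C : Type u} [Category.{v} C] [Abelian C] [HasExt.{w} C]
    [EnoughInjectives C] (n : ℕ) (K : C) : ∃ N : C, ∀ M : C,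
      Subsingleton (Ext.{w} M N 1) ↔ Subsingleton (Ext.{w} M K (n + 1)) := by
  induction n generalizing K with
  | zero => exact ⟨K, fun M => Iff.rfl⟩
  | succ n ih =>
    have hs : (ShortComplex.mk _ _ (Limits.cokernel.condition (Injective.ι K))).ShortExact :=
      { exact := ShortComplex.exact_cokernel _ }
    obtain ⟨N, hN⟩ := ih (Limits.cokernel (Injective.ι K))
    have : Injective (ShortComplex.mk _ _ (Limits.cokernel.condition (Injective.ι K))).X₂ :=
      inferInstanceAs (Injective (Injective.under K))
    exact ⟨N, fun M => (hN M).trans (subsingleton_ext_succ_iff M hs n).symm⟩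

end Modules

/-! ### Discs and spheres -/

section Discs

variable {R : Type u} [Ring R]

open Classical in
/-- The sum of the contractible complexes `N = N`, one for each pair of consecutive degrees: its
terms are `N × N` with differential `(a, b) ↦ (0, a)`. -/
noncomputable def discComplex (N : ModuleCat.{u} R) : ChainComplex (ModuleCat.{u} R) ℤ where
  X _ := ModuleCat.of R (N × N)
  d i j := if j + 1 = i then
    ModuleCat.ofHom (LinearMap.inr R N N ∘ₗ LinearMap.fst R N N) else 0
  shape i j h := if_neg h
  d_comp_d' i j k hij hjk := by
    have hij' : j + 1 = i := hij
    have hjk' : k + 1 = j := hjk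
    rw [if_pos hij', if_pos hjk']
    rfl

/-- The complex with all terms `N` and zero differential. -/
def sphereComplex (N : ModuleCat.{u} R) : ChainComplex (ModuleCat.{u} R) ℤ where
  X _ := N
  d _ _ := 0

lemma discComplex_d_apply (N : ModuleCat.{u} R) (j : ℤ) (x : N × N) :
    ((discComplex N).d (j + 1) j).hom x = ((0, x.1) : N × N) := by
  have h : (discComplex N).d (j + 1) j =
      ModuleCat.ofHom (LinearMap.inr R N N ∘ₗ LinearMap.fst R N N) := if_pos rfl
  exact LinearMap.congr_fun (congrArg (fun f => f.hom) h) x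

/-- Constructor for morphisms of complexes of modules. -/
def mkHom {X Y : ChainComplex (ModuleCat.{u} R) ℤ} (f : ∀ m, X.X m →ₗ[R] Y.X m)
    (h : ∀ m x, (Y.d (m + 1) m).hom (f (m + 1) x) = f m ((X.d (m + 1) m).hom x)) : X ⟶ Y where
  f m := ModuleCat.ofHom (f m)
  comm' i j hij := by
    have hij' : j + 1 = i := hij
    subst hij'
    ext x
    exact h j x

lemma hom_comm_apply {X Y : ChainComplex (ModuleCat.{u} R) ℤ} (f : X ⟶ Y) (i j : ℤ) (x : X.X i) :
    (Y.d i j).hom ((f.f i).hom x) = (f.f j).hom ((X.d i j).hom x) :=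
  LinearMap.congr_fun (congrArg (fun f => f.hom) (f.comm i j)) x

lemma d_comp_d_apply (X : ChainComplex (ModuleCat.{u} R) ℤ) (i j k : ℤ) (x : X.X i) :
    (X.d j k).hom ((X.d i j).hom x) = 0 :=
  LinearMap.congr_fun (congrArg (fun f => f.hom) (X.d_comp_d i j k)) x

/-- Morphisms to `discComplex N` are families of linear maps to `N`. -/
noncomputable def homToDisc {X : ChainComplex (ModuleCat.{u} R) ℤ} {N : ModuleCat.{u} R}
    (b : ∀ m, X.X m →ₗ[R] N) : X ⟶ discComplex N :=
  mkHom (fun m => ((b (m - 1)) ∘ₗ (X.d m (m - 1)).hom).prod (b m)) fun m x => by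
    refine (discComplex_d_apply N m _).trans (Prod.ext ?_ ?_)
    · change 0 = b (m - 1) ((X.d m (m - 1)).hom ((X.d (m + 1) m).hom x))
      rw [d_comp_d_apply, map_zero]
    · change b (m + 1 - 1) ((X.d (m + 1) (m + 1 - 1)).hom x) = b m ((X.d (m + 1) m).hom x)
      rw [add_sub_cancel_right]

lemma homToDisc_snd {X : ChainComplex (ModuleCat.{u} R) ℤ} {N : ModuleCat.{u} R}
    (b : ∀ m, X.X m →ₗ[R] N) (m : ℤ) (x : X.X m) :
    (show N × N from ((homToDisc b).f m).hom x).2 = b m x := rfl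

lemma toDisc_fst {X : ChainComplex (ModuleCat.{u} R) ℤ} {N : ModuleCat.{u} R}
    (f : X ⟶ discComplex N) (m : ℤ) (x : X.X (m + 1)) :
    (show N × N from (f.f (m + 1)).hom x).1 =
      (show N × N from (f.f m).hom ((X.d (m + 1) m).hom x)).2 := by
  rw [← hom_comm_apply]
  exact (congrArg Prod.snd (discComplex_d_apply N m _)).symm

lemma toDisc_ext {X : ChainComplex (ModuleCat.{u} R) ℤ} {N : ModuleCat.{u} R}
    {f g : X ⟶ discComplex N} (h : ∀ m x, (show N × N from (f.f m).hom x).2 =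
      (show N × N from (g.f m).hom x).2) : f = g := by
  ext m x
  obtain ⟨m, rfl⟩ : ∃ k, m = k + 1 := ⟨m - 1, by simp⟩
  refine Prod.ext ?_ (h _ _)
  exact (toDisc_fst f m x).trans ((h _ _).trans (toDisc_fst g m x).symm)

/-- The second components of a morphism to `discComplex N`. -/
noncomputable def toDiscSnd {X : ChainComplex (ModuleCat.{u} R) ℤ} {N : ModuleCat.{u} R}
    (f : X ⟶ discComplex N) (m : ℤ) : X.X m →ₗ[R] N :=
  LinearMap.snd R N N ∘ₗ (f.f m).hom

instance (J : ModuleCat.{u} R) [Injective J] : Injective (discComplex J) where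
  factors {A B} g i _ := by
    let b (m : ℤ) : B.X m ⟶ J := Injective.factorThru (ModuleCat.ofHom (toDiscSnd g m)) (i.f m)
    refine ⟨homToDisc fun m => (b m).hom, toDisc_ext fun m x => ?_⟩
    exact LinearMap.congr_fun (congrArg (fun f => f.hom) (Injective.comp_factorThru
      (ModuleCat.ofHom (toDiscSnd g m)) (i.f m))) x

/-- The functoriality of `discComplex`. -/
noncomputable def discMap {N N' : ModuleCat.{u} R} (f : N ⟶ N') : discComplex N ⟶ discComplex N' :=
  mkHom (fun _ => LinearMap.prodMap f.hom f.hom) fun m x => by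
    refine (discComplex_d_apply N' m _).trans ?_
    refine Eq.trans ?_ (congrArg (Prod.map f.hom f.hom) (discComplex_d_apply N m x)).symm
    exact Prod.ext (map_zero f.hom).symm rfl

lemma shortExact_disc {N J Q : ModuleCat.{u} R} (f : N ⟶ J) (g : J ⟶ Q) (h : f ≫ g = 0)
    (hs : (ShortComplex.mk f g h).ShortExact) :
    (ShortComplex.mk (discMap f) (discMap g) (by
      ext m x
      exact Prod.ext (LinearMap.congr_fun (congrArg (fun f => f.hom) h) x.1)
        (LinearMap.congr_fun (congrArg (fun f => f.hom) h) x.2))).ShortExact := by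
  have hf := (ModuleCat.mono_iff_injective f).1 hs.mono_f
  have hg := (ModuleCat.epi_iff_surjective g).1 hs.epi_g
  have hfg := (ShortComplex.ShortExact.moduleCat_exact_iff_function_exact _).1 hs.exact
  refine shortExact_of_degreewise _ _ _ (fun m => hf.prodMap hf) (fun m => hg.prodMap hg)
    fun m x => ?_
  refine Prod.ext_iff.trans (((hfg x.1).and (hfg x.2)).trans ?_)
  constructor
  · rintro ⟨⟨a, ha⟩, b, hb⟩
    exact ⟨(a, b), Prod.ext ha hb⟩
  · rintro ⟨⟨a, b⟩, rfl⟩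
    exact ⟨⟨a, rfl⟩, b, rfl⟩

/-- `Ext¹(X, discComplex N)` is the product of the `Ext¹(X.X m, N)`. -/
lemma subsingleton_ext_disc_iff (X : ChainComplex (ModuleCat.{u} R) ℤ) (N : ModuleCat.{u} R) :
    Subsingleton (Ext.{u} X (discComplex N) 1) ↔ ∀ m, Subsingleton (Ext.{u} (X.X m) N 1) := by
  have hs : (ShortComplex.mk _ _ (Limits.cokernel.condition (Injective.ι N))).ShortExact :=
    { exact := ShortComplex.exact_cokernel _ }
  have hd := shortExact_disc _ _ _ hs
  refine ⟨fun h m => ?_, fun h => ?_⟩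
  · refine subsingleton_ext_of_lift hs (Ext.subsingleton_of_injective _ _ 0) fun g => ?_
    obtain ⟨φ, hφ⟩ := exists_lift_of_subsingleton_ext hd h
      (homToDisc (Pi.single (M := fun m => X.X m →ₗ[R] (_ : ModuleCat.{u} R)) m g.hom))
    refine ⟨ModuleCat.ofHom (toDiscSnd φ m), ?_⟩
    ext x
    refine (congrArg (fun f => toDiscSnd f m x) hφ).trans ((homToDisc_snd _ m x).trans ?_)
    exact congrArg (· x) (Pi.single_eq_same (M := fun m => X.X m →ₗ[R] _) m g.hom)
  · refine subsingleton_ext_of_lift hd (Ext.subsingleton_of_injective _ _ 0) fun g => ?_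
    choose φ hφ using fun m => exists_lift_of_subsingleton_ext hs (h m)
      (ModuleCat.ofHom (toDiscSnd g m))
    refine ⟨homToDisc fun m => (φ m).hom, toDisc_ext fun m x => ?_⟩
    exact LinearMap.congr_fun (congrArg (fun f => f.hom) (hφ m)) x

/-- The inclusion of the cycles of `discComplex N`. -/
noncomputable def sphereToDisc (N : ModuleCat.{u} R) : sphereComplex N ⟶ discComplex N where
  f _ := (ModuleCat.ofHom (LinearMap.inr R N N) : N ⟶ ModuleCat.of R (N × N))
  comm' i j hij := by
    have hij' : j + 1 = i := hij
    subst hij'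
    ext x
    exact (discComplex_d_apply N j _).trans (map_zero (LinearMap.inr R N N)).symm

/-- The quotient of `discComplex N` by its cycles. -/
noncomputable def discToSphere (N : ModuleCat.{u} R) : discComplex N ⟶ sphereComplex N where
  f _ := (ModuleCat.ofHom (LinearMap.fst R N N) : ModuleCat.of R (N × N) ⟶ N)
  comm' i j hij := by
    have hij' : j + 1 = i := hij
    subst hij'
    ext x
    exact (congrArg Prod.fst (discComplex_d_apply N j x)).symm

lemma shortExact_sphere (N : ModuleCat.{u} R) :
    (ShortComplex.mk (sphereToDisc N) (discToSphere N) rfl).ShortExact :=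
  shortExact_of_degreewise _ _ _ (fun _ _ _ h => congrArg Prod.snd h)
    (fun _ x => ⟨(x, 0), rfl⟩) fun _ =>
      (Function.Exact.inr_fst : Function.Exact (LinearMap.inr R N N) (LinearMap.fst R N N))

/-- For injective `E`, a complex is left orthogonal to `sphereComplex E` if and only if each map
from a term to `E` which kills the boundaries factors through the differential. -/
lemma subsingleton_ext_sphere_iff (X : ChainComplex (ModuleCat.{u} R) ℤ) (E : ModuleCat.{u} R)
    [Injective E] : Subsingleton (Ext.{u} X (sphereComplex E) 1) ↔
      ∀ (m : ℤ) (φ : X.X (m + 1) →ₗ[R] E), φ ∘ₗ (X.d (m + 1 + 1) (m + 1)).hom = 0 →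
        ∃ b : X.X m →ₗ[R] E, b ∘ₗ (X.d (m + 1) m).hom = φ := by
  refine ⟨fun h m φ hφ => ?_, fun h => ?_⟩
  · let ψ : ∀ k, X.X k →ₗ[R] E := Pi.single (M := fun k => X.X k →ₗ[R] E) (m + 1) φ
    have hψ (k : ℤ) : ψ k ∘ₗ (X.d (k + 1) k).hom = 0 := by
      by_cases hk : k = m + 1
      · subst hk
        simpa only [ψ, Pi.single_eq_same] using hφ
      · simp only [ψ, Pi.single_eq_of_ne hk, LinearMap.zero_comp]
    obtain ⟨f, hf⟩ := exists_lift_of_subsingleton_ext (shortExact_sphere E) h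
      (mkHom (Y := sphereComplex E) ψ fun k x => (LinearMap.congr_fun (hψ k) x).symm)
    refine ⟨toDiscSnd f m, LinearMap.ext fun x => ?_⟩
    refine (toDisc_fst f m x).symm.trans ?_
    refine (LinearMap.congr_fun (congrArg (fun f => (f.f (m + 1)).hom) hf) x).trans ?_
    exact congrArg (· x) (Pi.single_eq_same (M := fun k => X.X k →ₗ[R] E) (m + 1) φ)
  · refine subsingleton_ext_of_lift (shortExact_sphere E)
      (Ext.subsingleton_of_injective X (discComplex E) 0) fun g => ?_
    choose b hb using fun m => h m (g.f (m + 1)).hom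
      (LinearMap.ext fun x => (hom_comm_apply g (m + 1 + 1) (m + 1) x).symm)
    refine ⟨homToDisc b, ?_⟩
    ext m x
    obtain ⟨m, rfl⟩ : ∃ k, m = k + 1 := ⟨m - 1, by simp⟩
    exact (toDisc_fst (homToDisc b) m x).trans (LinearMap.congr_fun (hb m) x)

/-- A family of elements defines a morphism from `discComplex R`. -/
noncomputable def homFromDisc {X : ChainComplex (ModuleCat.{u} R) ℤ} (x : ∀ m, X.X m) :
    discComplex (ModuleCat.of R R) ⟶ X :=
  mkHom (fun m => (LinearMap.toSpanSingleton R _ (x m)).coprod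
    (LinearMap.toSpanSingleton R _ ((X.d (m + 1) m).hom (x (m + 1))))) fun m y => by
    refine Eq.trans ?_ (congrArg _ (discComplex_d_apply (ModuleCat.of R R) m y)).symm
    change (X.d (m + 1) m).hom ((show R × R from y).1 • x (m + 1) + (show R × R from y).2 •
      (X.d (m + 1 + 1) (m + 1)).hom (x (m + 1 + 1))) = (0 : R) • x m +
      (show R × R from y).1 • (X.d (m + 1) m).hom (x (m + 1))
    rw [map_add, map_smul, map_smul, d_comp_d_apply, smul_zero, add_zero, zero_smul, zero_add]

lemma homFromDisc_apply {X : ChainComplex (ModuleCat.{u} R) ℤ} (x : ∀ m, X.X m) (m : ℤ) :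
    ((homFromDisc x).f m).hom ((1, 0) : R × R) = x m := by
  change (1 : R) • x m + (0 : R) • _ = _
  rw [one_smul, zero_smul, add_zero]

lemma fromDisc_ext {X : ChainComplex (ModuleCat.{u} R) ℤ}
    {f g : discComplex (ModuleCat.of R R) ⟶ X}
    (h : ∀ m, (f.f m).hom ((1, 0) : R × R) = (g.f m).hom ((1, 0) : R × R)) : f = g := by
  have h' (f : discComplex (ModuleCat.of R R) ⟶ X) (m) (a b : R) : (f.f m).hom ((a, b) : R × R) =
      a • (f.f m).hom ((1, 0) : R × R) +
        b • (X.d (m + 1) m).hom ((f.f (m + 1)).hom ((1, 0) : R × R)) := by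
    rw [(hom_comm_apply f (m + 1) m ((1, 0) : R × R)).trans
      (congrArg (f.f m).hom (discComplex_d_apply (ModuleCat.of R R) m ((1, 0) : R × R)))]
    refine Eq.trans ?_ ((map_add (f.f m).hom (a • ((1, 0) : R × R)) (b • ((0, 1) : R × R))).trans
      (congrArg₂ _ (map_smul (f.f m).hom _ _) (map_smul (f.f m).hom _ _)))
    exact congrArg (f.f m).hom (by simp : (a, b) = a • ((1, 0) : R × R) + b • ((0, 1) : R × R))
  ext m x
  exact (h' f m x.1 x.2).trans (by rw [h, h]; exact (h' g m x.1 x.2).symm)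

instance : Projective (discComplex (ModuleCat.of R R)) where
  factors {E X} f e _ := by
    have he (m) : Function.Surjective (e.f m).hom :=
      (ModuleCat.epi_iff_surjective (e.f m)).1 inferInstance
    choose y hy using fun m => he m ((f.f m).hom ((1, 0) : R × R))
    refine ⟨homFromDisc y, fromDisc_ext fun m => ?_⟩
    exact (congrArg (e.f m).hom (homFromDisc_apply y m)).trans (hy m)

lemma isSeparator_discComplex : IsSeparator (discComplex (ModuleCat.of R R)) := by
  rw [isSeparator_def]
  intro X Y f g h
  ext m x
  have := LinearMap.congr_fun (congrArg (fun f => (f.f m).hom)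
    (h (homFromDisc (Pi.single (M := fun k => X.X k) m x)))) ((1, 0) : R × R)
  have e := homFromDisc_apply (Pi.single (M := fun k => X.X k) m x) m
  rw [Pi.single_eq_same] at e
  exact (congrArg (f.f m).hom e).symm.trans (this.trans (congrArg (g.f m).hom e))

end Discs

/-! ### The double orthogonal -/

section Orthogonality

variable {R : Type u} [Ring R]

lemma nProjective_iff_subsingleton_ext {n : ℕ} {M : ModuleCat.{u} R} :
    nProjective R n M ↔ ∀ K : ModuleCat.{u} R, Subsingleton (Ext.{u} M K (n + 1)) := by
  refine ⟨fun h K => ?_, fun h => nProjective_of_hasProjectiveDimensionLE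
    (hasProjectiveDimensionLT_of_enoughInjectives M (n + 1) h)⟩
  have := hasProjectiveDimensionLE_of_nProjective h
  exact HasProjectiveDimensionLT.subsingleton M (n + 1) (n + 1) le_rfl K

/-- The disc on an `n`-th cosyzygy is right orthogonal to the complexes with terms of projective
dimension at most `n`. -/
lemma discComplex_mem_rightPerp {n : ℕ} {N K : ModuleCat.{u} R} (h : ∀ M : ModuleCat.{u} R,
    Subsingleton (Ext.{u} M N 1) ↔ Subsingleton (Ext.{u} M K (n + 1))) :
    rightPerp.{u + 1, u, u} (exTilde (nProjective R n)) (discComplex N) := fun X hX =>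
  (subsingleton_ext_disc_iff X N).2 fun m =>
    (h _).2 (nProjective_iff_subsingleton_ext.1 (hX.2 m) K)

lemma sphereComplex_mem_rightPerp {n : ℕ} (E : ModuleCat.{u} R) [Injective E] :
    rightPerp.{u + 1, u, u} (exTilde (nProjective R n)) (sphereComplex E) := by
  refine fun X hX => (subsingleton_ext_sphere_iff X E).2 fun m φ hφ => ?_
  have h := (X.exactAt_iff' (m + 1 + 1) (m + 1) m (by simp) (by simp)).1 (hX.1 (m + 1))
  have hφ' : (X.sc' (m + 1 + 1) (m + 1) m).f ≫ ModuleCat.ofHom φ = 0 :=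
    ModuleCat.hom_ext hφ
  exact ⟨(h.descToInjective _ hφ').hom,
    congrArg (fun f => f.hom) (h.comp_descToInjective _ hφ')⟩

/-- Orthogonality to the discs on `n`-th cosyzygies bounds the projective dimensions of the terms,
and orthogonality to the spheres on injective modules forces exactness. -/
theorem leftPerp_rightPerp_exTilde (n : ℕ) : leftPerp.{u + 1, u, u}
    (rightPerp.{u + 1, u, u} (exTilde (nProjective R n))) = exTilde (nProjective R n) := by
  refine le_antisymm (fun X hX => ⟨fun m => ?_, fun m => ?_⟩) (le_leftPerp_rightPerp _)
  · obtain ⟨m, rfl⟩ : ∃ k, m = k + 1 := ⟨m - 1, by simp⟩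
    rw [X.exactAt_iff' (m + 1 + 1) (m + 1) m (by simp) (by simp),
      ShortComplex.ShortExact.moduleCat_exact_iff_function_exact]
    -- test with an injective module containing the quotient by the boundaries
    let B := LinearMap.range (X.d (m + 1 + 1) (m + 1)).hom
    let Q := ModuleCat.of R (X.X (m + 1) ⧸ B)
    have hι := (ModuleCat.mono_iff_injective (Injective.ι Q)).1 inferInstance
    obtain ⟨b, hb⟩ := (subsingleton_ext_sphere_iff X (Injective.under Q)).1
      (hX _ (sphereComplex_mem_rightPerp _)) m ((Injective.ι Q).hom ∘ₗ B.mkQ) (by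
        ext x
        change (Injective.ι Q).hom (B.mkQ _) = 0
        rw [B.mkQ_apply, (Submodule.Quotient.mk_eq_zero B).2 ⟨x, rfl⟩, map_zero])
    intro x
    refine ⟨fun hx => ?_, ?_⟩
    · have hx' : (Injective.ι Q).hom (B.mkQ x) = 0 := by
        refine (LinearMap.congr_fun hb x).symm.trans ?_
        change b ((X.d (m + 1) m).hom x) = 0
        rw [show (X.d (m + 1) m).hom x = 0 from hx, map_zero]
      exact (Submodule.Quotient.mk_eq_zero B).1 (hι (hx'.trans (map_zero _).symm))
    · rintro ⟨y, rfl⟩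
      exact d_comp_d_apply X _ _ _ y
  · refine nProjective_iff_subsingleton_ext.2 fun K => ?_
    obtain ⟨N, hN⟩ := exists_cosyzygy.{u + 1, u, u} n K
    exact (hN _).1 ((subsingleton_ext_disc_iff X N).1 (hX _ (discComplex_mem_rightPerp hN)) m)

end Orthogonality

/-! ### Essential smallness -/

section EssentiallySmall

variable {R : Type u} [Ring R]

lemma smallNProjective_le_nProjective (n : ℕ) (κ : Cardinal.{u}) :
    smallNProjective R n κ ≤ nProjective R n := fun _ ⟨r, _⟩ => ⟨r⟩

lemma exTilde_mono {A B : ObjectProperty (ModuleCat.{u} R)} (h : A ≤ B) :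
    exTilde A ≤ exTilde B := fun _ hX => ⟨hX.1, fun m => h _ (hX.2 m)⟩

lemma exists_equiv_quotient_of_mk_le {κ : Cardinal.{u}} (M : ModuleCat.{u} R)
    (hM : Cardinal.mk M ≤ κ) :
    ∃ K : Submodule R (κ.out →₀ R), Nonempty (M ≃ₗ[R] ((κ.out →₀ R) ⧸ K)) := by
  obtain ⟨i⟩ : Nonempty (M ↪ κ.out) := by
    rw [← Cardinal.le_def, Cardinal.mk_out]
    exact hM
  let f : (κ.out →₀ R) →ₗ[R] M := Finsupp.linearCombination R (Function.invFun i)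
  have hf : Function.Surjective f :=
    Finsupp.linearCombination_surjective R (Function.invFun_surjective i.injective)
  exact ⟨LinearMap.ker f, ⟨(f.quotKerEquivOfSurjective hf).symm⟩⟩

/-- The complexes with terms of cardinality at most `κ` have isomorphic copies whose terms are
quotients of the free module on `κ` generators. -/
lemma essentiallySmall_of_mk_le (κ : Cardinal.{u}) :
    ObjectProperty.EssentiallySmall.{u} (fun X : ChainComplex (ModuleCat.{u} R) ℤ =>
      ∀ m, Cardinal.mk (X.X m) ≤ κ) := by
  let F := κ.out →₀ R
  let T := Σ K : ℤ → Submodule R F, {d : ∀ i j, (F ⧸ K i) →ₗ[R] (F ⧸ K j) //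
    (∀ i j, ¬ (ComplexShape.down ℤ).Rel i j → d i j = 0) ∧ ∀ i j k, d j k ∘ₗ d i j = 0}
  let obj (t : T) : ChainComplex (ModuleCat.{u} R) ℤ :=
    { X := fun m => ModuleCat.of R (F ⧸ t.1 m)
      d := fun i j => ModuleCat.ofHom (t.2.1 i j)
      shape := fun i j h => by rw [t.2.2.1 i j h]; rfl
      d_comp_d' := fun i j k _ _ => ModuleCat.hom_ext (t.2.2.2 i j k) }
  refine ⟨ObjectProperty.ofObj obj, inferInstance, fun X hX => ?_⟩
  choose K hK using fun m => exists_equiv_quotient_of_mk_le (X.X m) (hX m)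
  let e (m) := (hK m).some
  let t : T := ⟨K, fun i j => (e j).toLinearMap ∘ₗ (X.d i j).hom ∘ₗ (e i).symm.toLinearMap,
    fun i j h => by ext; simp [X.shape i j h], fun i j k => by
      ext x
      simp [d_comp_d_apply]⟩
  refine ⟨obj t, ⟨t⟩, ⟨HomologicalComplex.Hom.isoOfComponents
    (fun m => (e m).toModuleIso) fun i j _ => ?_⟩⟩
  ext x
  change e j ((X.d i j).hom ((e i).symm (e i x))) = e j ((X.d i j).hom x)
  rw [LinearEquiv.symm_apply_apply]

lemma mk_le_of_smallNProjective {n : ℕ} {κ : Cardinal.{u}} {M : ModuleCat.{u} R}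
    (h : smallNProjective R n κ M) : Cardinal.mk M ≤ κ := by
  obtain ⟨r, hr⟩ := h
  exact (Cardinal.mk_le_of_surjective r.surjective).trans (hr 0)

end EssentiallySmall

/-! ### Dependence of the right orthogonal class on the class -/

lemma rightPerp_antitone {C : Type u} [Category.{v} C] [Abelian C] [HasExt.{w} C]
    {P Q : ObjectProperty C} (h : P ≤ Q) : rightPerp.{u, v, w} Q ≤ rightPerp.{u, v, w} P :=
  fun _ hY X hX => hY X (h X hX)

lemma rightPerp_isoClosure {C : Type u} [Category.{v} C] [Abelian C] [HasExt.{w} C]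
    (P : ObjectProperty C) : rightPerp.{u, v, w} P.isoClosure = rightPerp.{u, v, w} P := by
  refine le_antisymm (rightPerp_antitone (ObjectProperty.le_isoClosure P)) ?_
  rintro Y hY X ⟨X', hX', ⟨e⟩⟩
  exact subsingleton_ext_of_iso e.symm Y 1 (hY X' hX')

/-! ### The cotorsion pair -/

theorem mainTheorem3 (R : Type u) [Ring R] (κ : Cardinal.{u}) (hκ : Cardinal.aleph0 ≤ κ)
    (hR : Cardinal.mk R ≤ κ) (n : ℕ) :
    (∀ X : ChainComplex (ModuleCat.{u} R) ℤ, exTilde (nProjective R n) X →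
      HasFiltration (exTilde (smallNProjective R n κ)) X) ∧
    ObjectProperty.EssentiallySmall.{u} (exTilde (smallNProjective R n κ)) ∧
    IsCompleteCotorsionPair.{u + 1, u, u} (exTilde (nProjective R n))
      (rightPerp.{u + 1, u, u} (exTilde (nProjective R n))) ∧
    IsCogeneratedBy.{u + 1, u, u} (exTilde (nProjective R n))
      (rightPerp.{u + 1, u, u} (exTilde (nProjective R n)))
      (exTilde (smallNProjective R n κ)) ∧
    ∃ T : ObjectProperty (ChainComplex (ModuleCat.{u} R) ℤ),
      ObjectProperty.Small.{u} T ∧ T ≤ exTilde (smallNProjective R n κ) ∧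
      IsCogeneratedBy.{u + 1, u, u} (exTilde (nProjective R n))
        (rightPerp.{u + 1, u, u} (exTilde (nProjective R n))) T := by
  have hle := exTilde_mono (smallNProjective_le_nProjective (R := R) n κ)
  have hess : ObjectProperty.EssentiallySmall.{u} (exTilde (smallNProjective R n κ)) :=
    have := essentiallySmall_of_mk_le (R := R) κ
    .of_le fun X hX m => mk_le_of_smallNProjective (hX.2 m)
  have hperp := le_antisymm (rightPerp_antitone hle) (rightPerp_small_le (n := n) hκ hR)
  obtain ⟨T, hT, hTle, hleT⟩ :=
    ObjectProperty.EssentiallySmall.exists_small_le.{u} (exTilde (smallNProjective R n κ))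
  have hperpT : rightPerp.{u + 1, u, u} (exTilde (nProjective R n)) =
      rightPerp.{u + 1, u, u} T := by
    rw [hperp]
    exact le_antisymm (rightPerp_antitone hTle)
      ((rightPerp_isoClosure T).ge.trans (rightPerp_antitone hleT))
  refine ⟨fun X hX => hasFiltration_of_exTilde hκ hR hX, hess, ?_, ⟨hle, hperp⟩,
    T, hT, hTle, hTle.trans hle, hperpT⟩
  -- index `T` by a type in the universe of the small object argument
  have hTobj : T = ObjectProperty.ofObj fun i : Shrink.{u} (Subtype T) =>
      ((equivShrink (Subtype T)).symm i).1 := by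
    ext X
    rw [ObjectProperty.ofObj_iff]
    refine ⟨fun hX => ⟨equivShrink _ ⟨X, hX⟩, by simp⟩, ?_⟩
    rintro ⟨i, rfl⟩
    exact ((equivShrink (Subtype T)).symm i).2
  have h := isCompleteCotorsionPair_of_set (isSeparator_discComplex (R := R))
    fun i : Shrink.{u} (Subtype T) => ((equivShrink (Subtype T)).symm i).1
  rwa [← hTobj, ← hperpT, leftPerp_rightPerp_exTilde] at h
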